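/- Let $\mu_0,\mu_1$ be compactly supported Borel probability measures on $\mathbb{R}^{d_0}$ and $\mathbb{R}^{d_1}$, and let $\varepsilon>0$. For $A\in\mathbb{R}^{d_0\times d_1}$ put $c_A(x,y)=-4\|x\|^2\|y\|^2-32\,x^{\top}Ay$ and $$\mathsf{OT}_{A,\varepsilon}(\mu_0,\mu_1)=\inf_{\pi\in\Pi(\mu_0,\mu_1)}\Big\{\int c_A\,d\pi+\varepsilon\,\mathsf{D}_{\mathsf{KL}}(\pi\,\|\,\mu_0\otimes\mu_1)\Big\},$$ where $\Pi(\mu_0,\mu_1)$ is the set of couplings of $\mu_0$ and $\mu_1$. This infimum is finite and is attained at a unique coupling $\pi_A$. Moreover, there are EOT potentials for $c_A$, that is, continuous functions $\varphi_0^A:\mathbb{R}^{d_0}\to\mathbb{R}$ and $\varphi_1^A:\mathbb{R}^{d_1}\to\mathbb{R}$ such that, for all $x\in\mathbb{R}^{d_0}$ and all $y\in\mathbb{R}^{d_1}$, $$\int e^{\frac{\varphi_0^A(x)+\varphi_1^A(y')-c_A(x,y')}{\varepsilon}}d\mu_1(y')=1,\qquad \int e^{\frac{\varphi_0^A(x')+\varphi_1^A(y)-c_A(x',y)}{\varepsilon}}d\mu_0(x')=1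 .$$ The function $\Phi:\mathbb{R}^{d_0\times d_1}\to\mathbb{R}$, $\Phi(A)=32\|A\|_F^2+\mathsf{OT}_{A,\varepsilon}(\mu_0,\mu_1)$, is smooth ($C^\infty$) and coercive (that is, $\Phi(A)\to+\infty$ as $\|A\|_F\to\infty$), and for all $A,B,C\in\mathbb{R}^{d_0\times d_1}$ its first and second Fréchet derivatives at $A$ are $$D\Phi_{[A]}(B)=64\,\mathrm{tr}(A^{\top}B)-32\int x^{\top}By\,d\pi_A(x,y),$$ $$D^2\Phi_{[A]}(B,C)=64\,\mathrm{tr}(B^{\top}C)+32\,\varepsilon^{-1}\int x^{\top}By\,\big(h_0(x)+h_1(y)-32\,x^{\top}Cy\big)\,d\pi_A(x,y).$$ Here, for any pair $(\varphi_0^A,\varphi_1^A)$ of EOT potentials for $c_A$, $(h_0,h_1)$ is the pair of continuous functions on $\mathrm{spt}(\mu_0)$ and $\mathrm{spt}(\mu_1)$, which exists and is unique up to replacing $(h_0,h_1)$ by $(h_0+a,h_1-a)$ with $a\in\mathbb{R}$, such that $$\int\big(h_0(x)+h_1(y)-32\,x^{\top}Cy\big)e^{\frac{\varphi_0^A(x)+\varphi_1^A(y)-c_A(x,y)}{\varepsilon}}d\mu_1(y)=0\quad\text{for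 all }x\in\mathrm{spt}(\mu_0),$$ $$\int\big(h_0(x)+h_1(y)-32\,x^{\top}Cy\big)e^{\frac{\varphi_0^A(x)+\varphi_1^A(y)-c_A(x,y)}{\varepsilon}}d\mu_0(x)=0\quad\text{for all }y\in\mathrm{spt}(\mu_1).$$ -/

import Mathlib

open MeasureTheory Filter InformationTheory
open scoped ContDiff Matrix Matrix.Norms.Frobenius

noncomputable section

/-- The bilinear form `xᵀ A y`. -/
def bilin {d₀ d₁ : ℕ} (A : Matrix (Fin d₀) (Fin d₁) ℝ)
    (x : EuclideanSpace ℝ (Fin d₀)) (y : EuclideanSpace ℝ (Fin d₁)) : ℝ :=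
  x.ofLp ⬝ᵥ (A *ᵥ y.ofLp)

/-- The cost function `c_A(x, y) = -4 ‖x‖² ‖y‖² - 32 xᵀ A y`. -/
def costA {d₀ d₁ : ℕ} (A : Matrix (Fin d₀) (Fin d₁) ℝ)
    (x : EuclideanSpace ℝ (Fin d₀)) (y : EuclideanSpace ℝ (Fin d₁)) : ℝ :=
  -4 * ‖x‖ ^ 2 * ‖y‖ ^ 2 - 32 * bilin A x y

/-- The set `Π(μ₀, μ₁)` of couplings: measures on the product with marginals `μ₀` and `μ₁`. -/
def couplings {X Y : Type*} [MeasurableSpace X] [MeasurableSpace Y]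
    (μ₀ : Measure X) (μ₁ : Measure Y) : Set (Measure (X × Y)) :=
  {π | π.map Prod.fst = μ₀ ∧ π.map Prod.snd = μ₁}

/-- The entropic transport objective `∫ c dπ + ε KL(π ‖ μ₀ ⊗ μ₁)`, with values in `(-∞, +∞]`.
It is used for costs that are integrable against every coupling (such as continuous costs with
compactly supported marginals) and for probability measures, for which `klDiv` is the usual
Kullback-Leibler divergence. -/
def eotObjective {X Y : Type*} [MeasurableSpace X] [MeasurableSpace Y]
    (μ₀ : Measure X) (μ₁ : Measure Y) (c : X → Y → ℝ) (ε : ℝ) (π : Measure (X × Y)) : EReal :=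
  ((∫ z, c z.1 z.2 ∂π : ℝ) : EReal) + (ε : EReal) * (klDiv π (μ₀.prod μ₁) : EReal)

/-- The entropic optimal transport cost, the infimum of the objective over all couplings. -/
def eotCost {X Y : Type*} [MeasurableSpace X] [MeasurableSpace Y]
    (μ₀ : Measure X) (μ₁ : Measure Y) (c : X → Y → ℝ) (ε : ℝ) : EReal :=
  ⨅ π ∈ couplings μ₀ μ₁, eotObjective μ₀ μ₁ c ε π

/-- `π` is an EOT coupling: a coupling at which the infimum is attained. -/
def IsEOTCoupling {X Y : Type*} [MeasurableSpace X] [MeasurableSpace Y]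
    (μ₀ : Measure X) (μ₁ : Measure Y) (c : X → Y → ℝ) (ε : ℝ) (π : Measure (X × Y)) : Prop :=
  π ∈ couplings μ₀ μ₁ ∧ eotObjective μ₀ μ₁ c ε π = eotCost μ₀ μ₁ c ε

/-- `(φ₀, φ₁)` is a pair of EOT potentials: continuous functions which satisfy the
Schrödinger system at all points. -/
structure IsEOTPotentials {X Y : Type*} [MeasurableSpace X] [MeasurableSpace Y]
    [TopologicalSpace X] [TopologicalSpace Y]
    (μ₀ : Measure X) (μ₁ : Measure Y) (c : X → Y → ℝ) (ε : ℝ)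
    (φ₀ : X → ℝ) (φ₁ : Y → ℝ) : Prop where
  continuous_fst : Continuous φ₀
  continuous_snd : Continuous φ₁
  system_fst : ∀ x, ∫ y, Real.exp ((φ₀ x + φ₁ y - c x y) / ε) ∂μ₁ = 1
  system_snd : ∀ y, ∫ x, Real.exp ((φ₀ x + φ₁ y - c x y) / ε) ∂μ₀ = 1

/-- `(h₀, h₁)` is a pair of functions, continuous on the supports of `μ₀` and `μ₁`, solving the
Schrödinger system for `c_A` linearized at the potentials `(φ₀, φ₁)` in the direction `C`.
Only the values of `h₀` and `h₁` on the supports matter. -/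
structure IsLinearizedSolution {d₀ d₁ : ℕ}
    (μ₀ : Measure (EuclideanSpace ℝ (Fin d₀))) (μ₁ : Measure (EuclideanSpace ℝ (Fin d₁)))
    (ε : ℝ) (A C : Matrix (Fin d₀) (Fin d₁) ℝ)
    (φ₀ : EuclideanSpace ℝ (Fin d₀) → ℝ) (φ₁ : EuclideanSpace ℝ (Fin d₁) → ℝ)
    (h₀ : EuclideanSpace ℝ (Fin d₀) → ℝ) (h₁ : EuclideanSpace ℝ (Fin d₁) → ℝ) : Prop where
  continuousOn_fst : ContinuousOn h₀ μ₀.support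
  continuousOn_snd : ContinuousOn h₁ μ₁.support
  system_fst : ∀ x ∈ μ₀.support,
    ∫ y, (h₀ x + h₁ y - 32 * bilin C x y) *
      Real.exp ((φ₀ x + φ₁ y - costA A x y) / ε) ∂μ₁ = 0
  system_snd : ∀ y ∈ μ₁.support,
    ∫ x, (h₀ x + h₁ y - 32 * bilin C x y) *
      Real.exp ((φ₀ x + φ₁ y - costA A x y) / ε) ∂μ₀ = 0

/-- The objective `Φ(A) = 32 ‖A‖_F² + OT_{A,ε}(μ₀, μ₁)`; the norm is the Frobenius norm. -/
def Phi {d₀ d₁ : ℕ}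
    (μ₀ : Measure (EuclideanSpace ℝ (Fin d₀))) (μ₁ : Measure (EuclideanSpace ℝ (Fin d₁)))
    (ε : ℝ) (A : Matrix (Fin d₀) (Fin d₁) ℝ) : ℝ :=
  32 * ‖A‖ ^ 2 + (eotCost μ₀ μ₁ (costA A) ε).toReal

end

/-! On the compact supports put `k = -c_A/ε`, which is affine in `A`. With potentials scaled by
`1/ε`, the Schrödinger system says that the Gibbs density `exp (u + v + k)` integrates to one in
each variable.

The analysis rests on one Doeblin-type estimate, `gibbs_average_sub_le`: if two exponents differ by
at most `r`, the corresponding Gibbs averages of `h` differ by at most `(1 - exp (-2r))` times the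
oscillation of `h`. Integrated along a segment, it shows that Sinkhorn half steps contract
oscillations, and this solves the nonlinear system (`exists_isSchrodinger`). Applied directly, it
shows that the Markov operators of the Gibbs density contract oscillations, so the linearized system
is invertible once the gauge `(u + a, v - a)` is fixed (`IsSchrodinger.existsUnique_linear`). The
implicit function theorem in `C(X) × C(Y)` then gives solutions depending smoothly on `k`
(`IsSchrodinger.exists_contDiffAt`), whose derivatives solve the linearized system.

The link with transport is `eotObjective_eq`: on couplings, the objective equals `∫ φ₀ + ∫ φ₁` plus
`ε` times the divergence from the Gibbs coupling. Hence the Gibbs coupling is the unique minimizer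
and the value is the sum of the means of the potentials. Smoothness follows. Integrating the
linearized system gives the first derivative of the value; differentiating the Gibbs density in that
formula gives the second. Coercivity holds because the transport cost is bounded below by an affine
function of `‖A‖`, against the quadratic term `32 ‖A‖²`. -/

namespace EntropicTransport

noncomputable section

/-! ### Calculus in `C(Z, ℝ)` and the oscillation contraction for Gibbs averages. -/

/-- The pointwise exponential of a continuous function. -/
def expMap {Z : Type*} [TopologicalSpace Z] (f : C(Z, ℝ)) : C(Z, ℝ) :=
  ⟨fun z => Real.exp (f z), by fun_prop⟩

@[simp]
theorem expMap_apply {Z : Type*} [TopologicalSpace Z] (f : C(Z, ℝ)) (z : Z) :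
    expMap f z = Real.exp (f z) := rfl

/-- Identifying the pointwise exponential with that of the Banach algebra `C(Z, ℝ)` makes its
smoothness and its derivative available at once. -/
theorem expMap_eq_exp {Z : Type*} [TopologicalSpace Z] [CompactSpace Z] :
    (expMap : C(Z, ℝ) → C(Z, ℝ)) = NormedSpace.exp := by
  ext f z
  have h := NormedSpace.map_exp (ContinuousMap.evalAlgHom ℝ ℝ z)
    (continuous_eval_const z) f
  rw [← Real.exp_eq_exp_ℝ] at h
  exact h.symm

theorem contDiff_expMap {Z : Type*} [TopologicalSpace Z] [CompactSpace Z] {n : WithTop ℕ∞} :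
    ContDiff ℝ n (expMap : C(Z, ℝ) → C(Z, ℝ)) := by
  rw [expMap_eq_exp, contDiff_iff_contDiffAt]
  exact fun f => (NormedSpace.exp_analytic (𝕂 := ℝ) f).contDiffAt

theorem hasStrictFDerivAt_expMap {Z : Type*} [TopologicalSpace Z] [CompactSpace Z] (f : C(Z, ℝ)) :
    HasStrictFDerivAt (expMap : C(Z, ℝ) → C(Z, ℝ))
      (expMap f • (1 : C(Z, ℝ) →L[ℝ] C(Z, ℝ))) f := by
  rw [expMap_eq_exp]
  exact hasStrictFDerivAt_exp

/-- Precomposition with a continuous map, as a continuous linear map. -/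
def precompL {Z W : Type*} [TopologicalSpace Z] [TopologicalSpace W] (g : C(Z, W)) :
    C(W, ℝ) →L[ℝ] C(Z, ℝ) where
  toFun f := f.comp g
  map_add' _ _ := rfl
  map_smul' _ _ := rfl
  cont := ContinuousMap.continuous_precomp g

@[simp]
theorem precompL_apply {Z W : Type*} [TopologicalSpace Z] [TopologicalSpace W] (g : C(Z, W))
    (f : C(W, ℝ)) (z : Z) : precompL g f z = f (g z) := rfl

theorem integrable_continuousMap {Z : Type*} [TopologicalSpace Z] [CompactSpace Z]
    [MeasurableSpace Z] [OpensMeasurableSpace Z] (ν : Measure Z) [IsFiniteMeasure ν]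
    (f : C(Z, ℝ)) : Integrable (fun z => f z) ν :=
  (BoundedContinuousFunction.mkOfCompact f).integrable ν

/-- Integration of continuous functions, as a continuous linear functional. -/
def integralL {Z : Type*} [TopologicalSpace Z] [CompactSpace Z] [MeasurableSpace Z]
    [OpensMeasurableSpace Z] (ν : Measure Z) [IsProbabilityMeasure ν] : C(Z, ℝ) →L[ℝ] ℝ :=
  LinearMap.mkContinuous
    { toFun := fun f => ∫ z, f z ∂ν
      map_add' := fun f g =>
        integral_add (integrable_continuousMap ν f) (integrable_continuousMap ν g)
      map_smul' := fun c f => integral_const_mul c _ } 1 fun f => by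
    simpa using norm_integral_le_of_norm_le_const (μ := ν) (ae_of_all _ f.norm_coe_le_norm)

@[simp]
theorem integralL_apply {Z : Type*} [TopologicalSpace Z] [CompactSpace Z] [MeasurableSpace Z]
    [OpensMeasurableSpace Z] (ν : Measure Z) [IsProbabilityMeasure ν] (f : C(Z, ℝ)) :
    integralL ν f = ∫ z, f z ∂ν := rfl

/-- The average of the second variable, as a continuous linear map `C(X × Y) → C(X)`. -/
def partialIntegral (X : Type*) {Y : Type*} [TopologicalSpace X] [CompactSpace X]
    [TopologicalSpace Y] [CompactSpace Y] [MeasurableSpace Y] [OpensMeasurableSpace Y]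
    (ν : Measure Y) [IsProbabilityMeasure ν] : C(X × Y, ℝ) →L[ℝ] C(X, ℝ) :=
  LinearMap.mkContinuous
    { toFun := fun f => ⟨fun x => integralL ν (f.curry x), by fun_prop⟩
      map_add' := fun f g => by
        ext x
        exact (integralL ν).map_add (f.curry x) (g.curry x)
      map_smul' := fun c f => by
        ext x
        exact (integralL ν).map_smul c (f.curry x) } 1 fun f => by
    rw [one_mul]
    refine (ContinuousMap.norm_le _ (norm_nonneg f)).2 fun x => ?_
    simpa using norm_integral_le_of_norm_le_const (μ := ν)
      (ae_of_all _ fun y => f.norm_coe_le_norm (x, y))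

/-- The bound is independent of `v`, so the contraction factor depends on the kernel alone; `2 *
‖k‖` is the value of `r` that enters `contractionConst`. -/
theorem abs_curry_sub_le {X Y : Type*} [TopologicalSpace X] [CompactSpace X] [TopologicalSpace Y]
    [CompactSpace Y] (k : C(X × Y, ℝ)) (v : C(Y, ℝ)) (x x' : X) (y : Y) :
    |(v + k.curry x) y - (v + k.curry x') y| ≤ 2 * ‖k‖ := by
  have h₁ := abs_le.1 (k.norm_coe_le_norm (x, y))
  have h₂ := abs_le.1 (k.norm_coe_le_norm (x', y))
  simp only [ContinuousMap.add_apply, ContinuousMap.curry_apply]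
  rw [abs_le]
  constructor <;> linarith [h₁.1, h₁.2, h₂.1, h₂.2]

section Contraction

variable {X Y : Type*} [TopologicalSpace X] [CompactSpace X] [TopologicalSpace Y] [CompactSpace Y]
  [MeasurableSpace Y] [OpensMeasurableSpace Y]

@[simp]
theorem partialIntegral_apply (ν : Measure Y) [IsProbabilityMeasure ν] (f : C(X × Y, ℝ)) (x : X) :
    partialIntegral X ν f x = ∫ y, f (x, y) ∂ν := rfl

/-- The oscillation of `h` is at most `s`. -/
def OscLE {Z : Type*} [TopologicalSpace Z] (h : C(Z, ℝ)) (s : ℝ) : Prop :=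
  ∀ z z', h z - h z' ≤ s

theorem oscLE_two_mul_norm {Z : Type*} [TopologicalSpace Z] [CompactSpace Z] (h : C(Z, ℝ)) :
    OscLE h (2 * ‖h‖) := fun z z' => by
  have h₁ := abs_le.1 (h.norm_coe_le_norm z)
  have h₂ := abs_le.1 (h.norm_coe_le_norm z')
  linarith [h₁.2, h₂.1]

theorem abs_sub_integral_le {ν : Measure Y} [IsProbabilityMeasure ν] {h : C(Y, ℝ)} {s : ℝ}
    (hs : OscLE h s) (y : Y) : |h y - ∫ z, h z ∂ν| ≤ s := by
  have hi := integrable_continuousMap ν h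
  have e : h y - ∫ z, h z ∂ν = ∫ z, (h y - h z) ∂ν := by
    rw [integral_sub (integrable_const _) hi]
    simp
  rw [e]
  have := norm_integral_le_of_norm_le_const (μ := ν) (f := fun z => h y - h z) (C := s)
    (ae_of_all _ fun z => abs_le.2 ⟨by linarith [hs z y], hs y z⟩)
  simpa using this

/-- Averages with respect to two densities, one of which dominates a multiple of the other. -/
theorem integral_mul_sub_integral_mul_le {ν : Measure Y} [IsProbabilityMeasure ν]
    {f g h : C(Y, ℝ)} {δ s : ℝ} (hf : ∫ y, f y ∂ν = 1) (hg : ∫ y, g y ∂ν = 1)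
    (hg0 : ∀ y, 0 ≤ g y) (hδ : δ ≤ 1) (hfg : ∀ y, δ * g y ≤ f y) (hs : OscLE h s) :
    ∫ y, f y * h y ∂ν - ∫ y, g y * h y ∂ν ≤ (1 - δ) * s := by
  have : Nonempty Y := nonempty_of_isProbabilityMeasure ν
  obtain ⟨m, -, hm⟩ := isCompact_univ.exists_isMaxOn Set.univ_nonempty h.continuous.continuousOn
  have hm' : ∀ y, h y ≤ h m := fun y => hm (Set.mem_univ y)
  have If := integrable_continuousMap ν f
  have Ig := integrable_continuousMap ν g
  have Ifh := integrable_continuousMap ν (f * h)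
  have Igh := integrable_continuousMap ν (g * h)
  simp only [ContinuousMap.mul_apply] at Ifh Igh
  -- The part `δ g` common to both densities contributes equally to both averages. The remainder `f
  -- - δ g` is nonnegative of mass `1 - δ`, and `h` is at most its maximum `h m` there.
  have h₁ : 0 ≤ ∫ y, (f y - δ * g y) * (h m - h y) ∂ν :=
    integral_nonneg fun y => mul_nonneg (sub_nonneg.2 (hfg y)) (sub_nonneg.2 (hm' y))
  have e₁ : ∫ y, (f y - δ * g y) * (h m - h y) ∂ν =
      h m - ∫ y, f y * h y ∂ν - δ * (h m - ∫ y, g y * h y ∂ν) := by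
    have : ∀ y, (f y - δ * g y) * (h m - h y) =
        h m * f y - f y * h y - δ * (h m * g y - g y * h y) := fun y => by ring
    simp only [this]
    have J₁ : Integrable (fun y => h m * f y - f y * h y) ν := (If.const_mul _).sub Ifh
    have J₂ : Integrable (fun y => h m * g y - g y * h y) ν := (Ig.const_mul _).sub Igh
    rw [integral_sub J₁ (J₂.const_mul δ), integral_sub (If.const_mul _) Ifh, integral_const_mul, integral_const_mul,
      integral_sub (Ig.const_mul _) Igh, integral_const_mul, hf, hg]
    ring
  have h₂ : h m - ∫ y, g y * h y ∂ν ≤ s := by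
    have : 0 ≤ ∫ y, g y * (s - (h m - h y)) ∂ν :=
      integral_nonneg fun y => mul_nonneg (hg0 y) (sub_nonneg.2 (hs m y))
    have e : ∀ y, g y * (s - (h m - h y)) = (s - h m) * g y + g y * h y := fun y => by ring
    simp only [e] at this
    rw [integral_add (Ig.const_mul _) Igh, integral_const_mul, hg] at this
    linarith
  nlinarith

theorem integral_expMap_pos (ν : Measure Y) [IsProbabilityMeasure ν] (a : C(Y, ℝ)) :
    0 < ∫ y, Real.exp (a y) ∂ν :=
  integral_exp_pos (integrable_continuousMap ν (expMap a))

/-- Averages with respect to two Gibbs densities with nearby exponents. -/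
theorem gibbs_average_sub_le {ν : Measure Y} [IsProbabilityMeasure ν] {a b h : C(Y, ℝ)} {r s : ℝ}
    (hab : ∀ y, |a y - b y| ≤ r) (hs : OscLE h s) :
    (∫ y, Real.exp (a y) * h y ∂ν) / (∫ y, Real.exp (a y) ∂ν) -
      (∫ y, Real.exp (b y) * h y ∂ν) / (∫ y, Real.exp (b y) ∂ν) ≤ (1 - Real.exp (-(2 * r))) * s := by
  have : Nonempty Y := nonempty_of_isProbabilityMeasure ν
  have hr : 0 ≤ r := (abs_nonneg _).trans (hab (Classical.arbitrary Y))
  set A := ∫ y, Real.exp (a y) ∂ν with hA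
  set B := ∫ y, Real.exp (b y) ∂ν with hB
  have hA0 : 0 < A := integral_expMap_pos ν a
  have hB0 : 0 < B := integral_expMap_pos ν b
  have hAB : A ≤ Real.exp r * B := by
    rw [hA, hB, ← integral_const_mul]
    refine integral_mono (integrable_continuousMap ν (expMap a))
      ((integrable_continuousMap ν (expMap b)).const_mul _) fun y => ?_
    simp only [← Real.exp_add]
    exact Real.exp_le_exp.2 (by linarith [(abs_le.1 (hab y)).2])
  -- One factor `exp (-r)` pays for the change of exponent, the other for the change of normalizing
  -- constant.
  have key := integral_mul_sub_integral_mul_le (ν := ν) (f := A⁻¹ • expMap a) (g := B⁻¹ • expMap b)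
    (h := h) (δ := Real.exp (-(2 * r))) (s := s) ?_ ?_ ?_ ?_ ?_ hs
  · simp only [ContinuousMap.smul_apply, expMap_apply, smul_eq_mul, mul_assoc,
      integral_const_mul] at key
    simpa only [div_eq_inv_mul] using key
  · simp only [ContinuousMap.smul_apply, expMap_apply, smul_eq_mul, integral_const_mul]
    exact inv_mul_cancel₀ hA0.ne'
  · simp only [ContinuousMap.smul_apply, expMap_apply, smul_eq_mul, integral_const_mul]
    exact inv_mul_cancel₀ hB0.ne'
  · intro y
    simp only [ContinuousMap.smul_apply, expMap_apply, smul_eq_mul]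
    positivity
  · exact Real.exp_le_one_iff.2 (by linarith)
  · intro y
    simp only [ContinuousMap.smul_apply, expMap_apply, smul_eq_mul]
    have h₁ : Real.exp (b y) ≤ Real.exp r * Real.exp (a y) := by
      rw [← Real.exp_add]
      exact Real.exp_le_exp.2 (by linarith [(abs_le.1 (hab y)).1])
    have h₂ : B⁻¹ ≤ Real.exp r * A⁻¹ := by
      rw [← div_eq_mul_inv, le_div_iff₀ hA0, inv_mul_le_iff₀ hB0]
      linarith
    calc Real.exp (-(2 * r)) * (B⁻¹ * Real.exp (b y))
        ≤ Real.exp (-(2 * r)) * (Real.exp r * A⁻¹ * (Real.exp r * Real.exp (a y))) := by gcongr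
      _ = Real.exp (-(2 * r) + r + r) * (A⁻¹ * Real.exp (a y)) := by
          rw [Real.exp_add, Real.exp_add]
          ring
      _ = A⁻¹ * Real.exp (a y) := by
          rw [show -(2 * r) + r + r = 0 by ring, Real.exp_zero, one_mul]

theorem hasDerivAt_log_integral_exp (ν : Measure Y) [IsProbabilityMeasure ν] (a h : C(Y, ℝ))
    (t : ℝ) :
    HasDerivAt (fun t : ℝ => Real.log (∫ y, Real.exp ((a + t • h) y) ∂ν))
      ((∫ y, Real.exp ((a + t • h) y) * h y ∂ν) / ∫ y, Real.exp ((a + t • h) y) ∂ν) t := by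
  have h₁ : HasDerivAt (fun t : ℝ => a + t • h) h t := by
    simpa using ((hasDerivAt_id t).smul_const h).const_add a
  have h₂ := ((integralL ν).hasFDerivAt.comp _
    (hasStrictFDerivAt_expMap (a + t • h)).hasFDerivAt).comp_hasDerivAt t h₁
  exact HasDerivAt.log h₂ (integral_expMap_pos ν _).ne'

/-- The log-sum-exp functional contracts differences of nearby exponents. -/
theorem log_integral_exp_sub_le {ν : Measure Y} [IsProbabilityMeasure ν] {a b h : C(Y, ℝ)}
    {r s : ℝ} (hab : ∀ y, |a y - b y| ≤ r) (hs : OscLE h s) :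
    (Real.log (∫ y, Real.exp ((a + h) y) ∂ν) - Real.log (∫ y, Real.exp ((b + h) y) ∂ν)) -
      (Real.log (∫ y, Real.exp (a y) ∂ν) - Real.log (∫ y, Real.exp (b y) ∂ν)) ≤
      (1 - Real.exp (-(2 * r))) * s := by
  -- Mean value theorem along `t ↦ a + t h` and `t ↦ b + t h`: the derivative is a difference of
  -- Gibbs averages of `h`, and the two exponents stay within `r` for every `t`.
  have hd := fun t =>
    (hasDerivAt_log_integral_exp ν a h t).sub (hasDerivAt_log_integral_exp ν b h t)
  obtain ⟨t, -, ht⟩ := exists_hasDerivAt_eq_slope _ _ zero_lt_one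
    (fun t _ => (hd t).continuousAt.continuousWithinAt) (fun t _ => hd t)
  have hb := gibbs_average_sub_le (ν := ν) (a := a + t • h) (b := b + t • h) (r := r)
    (fun y => by simpa using hab y) hs
  rw [ht] at hb
  simpa using hb

/-- The Sinkhorn half step `v ↦ -log ∫ exp (v + k)`. -/
def sinkhorn (ν : Measure Y) [IsProbabilityMeasure ν] (k : C(X × Y, ℝ)) (v : C(Y, ℝ)) : C(X, ℝ) :=
  ⟨fun x => -Real.log (partialIntegral X ν (expMap (precompL ContinuousMap.snd v + k)) x),
    (Continuous.log (map_continuous _) fun x =>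
      (integral_expMap_pos ν (v + k.curry x)).ne').neg⟩

theorem sinkhorn_apply (ν : Measure Y) [IsProbabilityMeasure ν] (k : C(X × Y, ℝ)) (v : C(Y, ℝ))
    (x : X) : sinkhorn ν k v x = -Real.log (∫ y, Real.exp ((v + k.curry x) y) ∂ν) := rfl

/-- The contraction constant of the Sinkhorn half step. -/
def contractionConst {Z : Type*} [TopologicalSpace Z] [CompactSpace Z] (k : C(Z, ℝ)) : ℝ :=
  1 - Real.exp (-(2 * (2 * ‖k‖)))

theorem contractionConst_nonneg {Z : Type*} [TopologicalSpace Z] [CompactSpace Z] (k : C(Z, ℝ)) :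
    0 ≤ contractionConst k :=
  sub_nonneg.2 (Real.exp_le_one_iff.2 (by linarith [norm_nonneg k]))

theorem contractionConst_lt_one {Z : Type*} [TopologicalSpace Z] [CompactSpace Z] (k : C(Z, ℝ)) :
    contractionConst k < 1 :=
  sub_lt_self _ (Real.exp_pos _)

/-- Comparing the values at `x` and `x'` turns the claim into a log-sum-exp increment in the
direction `v - w`, taken at the base exponents `w + k(x', ·)` and `w + k(x, ·)`. -/
theorem oscLE_sinkhorn_sub (ν : Measure Y) [IsProbabilityMeasure ν] (k : C(X × Y, ℝ))
    {v w : C(Y, ℝ)} {s : ℝ} (hs : OscLE (v - w) s) :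
    OscLE (sinkhorn ν k v - sinkhorn ν k w) (contractionConst k * s) := fun x x' => by
  have h := log_integral_exp_sub_le (ν := ν) (a := w + k.curry x') (b := w + k.curry x)
    (abs_curry_sub_le k w x' x) hs
  rw [show w + k.curry x' + (v - w) = v + k.curry x' by abel,
    show w + k.curry x + (v - w) = v + k.curry x by abel] at h
  simp only [ContinuousMap.sub_apply, sinkhorn_apply]
  unfold contractionConst
  linarith

/-- The Markov operator with kernel `exp (u + v + k)` contracts the oscillation. -/
theorem oscLE_partialIntegral (ν : Measure Y) [IsProbabilityMeasure ν] (k : C(X × Y, ℝ))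
    {u : C(X, ℝ)} {v h : C(Y, ℝ)} {s : ℝ}
    (hk : ∀ x, ∫ y, Real.exp (u x + v y + k (x, y)) ∂ν = 1) (hs : OscLE h s) (g : C(X, ℝ))
    (hg : ∀ x, g x = ∫ y, Real.exp (u x + v y + k (x, y)) * h y ∂ν) :
    OscLE g (contractionConst k * s) := by
  have e : ∀ x, g x = (∫ y, Real.exp ((v + k.curry x) y) * h y ∂ν) /
      ∫ y, Real.exp ((v + k.curry x) y) ∂ν := fun x => by
    have h₁ := hk x
    have h₂ := hg x
    simp only [add_assoc, Real.exp_add (u x), mul_assoc, integral_const_mul] at h₁ h₂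
    have h₃ : ∫ y, Real.exp ((v + k.curry x) y) ∂ν = (Real.exp (u x))⁻¹ :=
      eq_inv_of_mul_eq_one_right h₁
    rw [h₃, h₂, div_inv_eq_mul, mul_comm]
    rfl
  intro x x'
  rw [e, e]
  exact gibbs_average_sub_le (abs_curry_sub_le k v x x') hs

end Contraction

end

end EntropicTransport

set_option linter.unusedSectionVars false

/-! ### The Schrödinger system on compact spaces: existence, linearization, smooth dependence. -/

namespace EntropicTransport

noncomputable section

/-- A self-map of `C(Y)` that contracts oscillations and whose increments have mean zero has a
unique fixed point. -/
theorem existsUnique_fixedPoint {Y : Type*} [TopologicalSpace Y] [CompactSpace Y]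
    [MeasurableSpace Y] [OpensMeasurableSpace Y] (ν : Measure Y) [IsProbabilityMeasure ν]
    {f : C(Y, ℝ) → C(Y, ℝ)} {κ : ℝ} (hκ : 0 ≤ κ) (hκ1 : κ < 1)
    (hf : ∀ v w s, OscLE (v - w) s → OscLE (f v - f w) (κ * s))
    (hm : ∀ v w, integralL ν (f v - f w) = 0) : ∃! v, f v = v := by
  have osc : ∀ n v w, OscLE (f^[n] v - f^[n] w) (κ ^ n * (2 * ‖v - w‖)) := by
    intro n
    induction n with
    | zero => intro v w; simpa using oscLE_two_mul_norm (v - w)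
    | succ n ih =>
      intro v w
      rw [Function.iterate_succ_apply', Function.iterate_succ_apply', pow_succ', mul_assoc]
      exact hf _ _ _ (ih v w)
  -- Oscillation is at most twice the norm, and a function of mean zero has norm at most its
  -- oscillation. An iterate with `2 κ ^ (n + 1) < 1` is thus a norm contraction; the exponent `n +
  -- 1` ensures a last application of `f`, which makes the increment have mean zero.
  obtain ⟨n, hn⟩ := exists_pow_lt_of_lt_one (show (0 : ℝ) < 2⁻¹ by norm_num) hκ1
  have hn1 : κ ^ (n + 1) * 2 < 1 := by
    have : κ ^ (n + 1) ≤ κ ^ n := pow_le_pow_of_le_one hκ hκ1.le n.le_succ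
    linarith
  have hK : 0 ≤ κ ^ (n + 1) * 2 := by positivity
  have hc : ContractingWith (NNReal.mk (κ ^ (n + 1) * 2) hK) f^[n + 1] := by
    refine ⟨hn1, LipschitzWith.of_dist_le_mul fun v w => ?_⟩
    rw [dist_eq_norm, dist_eq_norm, NNReal.coe_mk, mul_assoc]
    refine (ContinuousMap.norm_le _ (by positivity)).2 fun y => ?_
    have h₁ := abs_sub_integral_le (ν := ν) (osc (n + 1) v w) y
    have h₂ : ∫ z, (f^[n + 1] v - f^[n + 1] w) z ∂ν = 0 := by
      rw [Function.iterate_succ_apply', Function.iterate_succ_apply']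
      exact hm _ _
    rwa [h₂, sub_zero] at h₁
  refine ⟨_, hc.isFixedPt_fixedPoint_iterate, fun w hw => ?_⟩
  exact hc.fixedPoint_unique (Function.IsFixedPt.iterate hw (n + 1))

variable {X Y : Type*} [TopologicalSpace X] [CompactSpace X] [TopologicalSpace Y] [CompactSpace Y]

/-- `(u, v) ↦ u(x) + v(y)` as a continuous linear map. -/
def sumL : C(X, ℝ) × C(Y, ℝ) →L[ℝ] C(X × Y, ℝ) :=
  (precompL ContinuousMap.fst).coprod (precompL ContinuousMap.snd)

@[simp]
theorem sumL_apply (w : C(X, ℝ) × C(Y, ℝ)) (z : X × Y) : sumL w z = w.1 z.1 + w.2 z.2 := rfl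

/-- The Gibbs density `exp (u + v + k)`. -/
def gibbs (k : C(X × Y, ℝ)) (w : C(X, ℝ) × C(Y, ℝ)) : C(X × Y, ℝ) := expMap (sumL w + k)

theorem gibbs_apply (k : C(X × Y, ℝ)) (w : C(X, ℝ) × C(Y, ℝ)) (z : X × Y) :
    gibbs k w z = Real.exp (w.1 z.1 + w.2 z.2 + k z) := rfl

variable [SecondCountableTopology X] [SecondCountableTopology Y]
  [MeasurableSpace X] [BorelSpace X] [MeasurableSpace Y] [BorelSpace Y]
  (ν₀ : Measure X) (ν₁ : Measure Y) [IsProbabilityMeasure ν₀] [IsProbabilityMeasure ν₁]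

/-- The average of the first variable, as a continuous linear map `C(X × Y) → C(Y)`. -/
def partialIntegralFst (Y : Type*) [TopologicalSpace Y] [CompactSpace Y] :
    C(X × Y, ℝ) →L[ℝ] C(Y, ℝ) :=
  partialIntegral Y ν₀ ∘L precompL ContinuousMap.prodSwap

@[simp]
theorem partialIntegralFst_apply (f : C(X × Y, ℝ)) (y : Y) :
    partialIntegralFst ν₀ Y f y = ∫ x, f (x, y) ∂ν₀ := rfl

theorem integralL_partialIntegral (f : C(X × Y, ℝ)) :
    integralL ν₀ (partialIntegral X ν₁ f) = ∫ z, f z ∂ν₀.prod ν₁ :=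
  (integral_prod _ (integrable_continuousMap (ν₀.prod ν₁) f)).symm

theorem integralL_partialIntegralFst (f : C(X × Y, ℝ)) :
    integralL ν₁ (partialIntegralFst ν₀ Y f) = ∫ z, f z ∂ν₀.prod ν₁ :=
  (integral_prod_symm _ (integrable_continuousMap (ν₀.prod ν₁) f)).symm

/-- The Schrödinger system for the exponent `k`: the Gibbs density has constant marginals. -/
def IsSchrodinger (k : C(X × Y, ℝ)) (w : C(X, ℝ) × C(Y, ℝ)) : Prop :=
  partialIntegral X ν₁ (gibbs k w) = 1 ∧ partialIntegralFst ν₀ Y (gibbs k w) = 1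

/-- The linearized Schrödinger system. -/
def IsLinSchrodinger (k : C(X × Y, ℝ)) (w : C(X, ℝ) × C(Y, ℝ)) (κ : C(X × Y, ℝ))
    (h : C(X, ℝ) × C(Y, ℝ)) : Prop :=
  partialIntegral X ν₁ (gibbs k w * (sumL h + κ)) = 0 ∧
    partialIntegralFst ν₀ Y (gibbs k w * (sumL h + κ)) = 0

variable {ν₀ ν₁} {k : C(X × Y, ℝ)} {w : C(X, ℝ) × C(Y, ℝ)}

theorem IsSchrodinger.integral_fst (hw : IsSchrodinger ν₀ ν₁ k w) (x : X) :
    ∫ y, Real.exp (w.1 x + w.2 y + k (x, y)) ∂ν₁ = 1 := DFunLike.congr_fun hw.1 x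

theorem IsSchrodinger.integral_snd (hw : IsSchrodinger ν₀ ν₁ k w) (y : Y) :
    ∫ x, Real.exp (w.1 x + w.2 y + k (x, y)) ∂ν₀ = 1 := DFunLike.congr_fun hw.2 y

/-- With its mirror image, this writes the linearized operator as the identity plus off-diagonal
Markov operators. -/
theorem IsSchrodinger.partialIntegral_mul_fst (hw : IsSchrodinger ν₀ ν₁ k w) (g : C(X, ℝ)) :
    partialIntegral X ν₁ (gibbs k w * precompL ContinuousMap.fst g) = g := by
  ext x
  change ∫ y, gibbs k w (x, y) * g x ∂ν₁ = g x
  rw [integral_mul_const]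
  simp [gibbs_apply, hw.integral_fst x]

theorem IsSchrodinger.partialIntegralFst_mul_snd (hw : IsSchrodinger ν₀ ν₁ k w) (h : C(Y, ℝ)) :
    partialIntegralFst ν₀ Y (gibbs k w * precompL ContinuousMap.snd h) = h := by
  ext y
  change ∫ x, gibbs k w (x, y) * h y ∂ν₀ = h y
  rw [integral_mul_const]
  simp [gibbs_apply, hw.integral_snd y]

/-- The composite of two Sinkhorn half steps is iterated modulo constants. A fixed point might solve
the second equation only up to a factor, which equality of total masses forces to be one. -/
theorem exists_isSchrodinger (k : C(X × Y, ℝ)) :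
    ∃ w, IsSchrodinger ν₀ ν₁ k w ∧ integralL ν₁ w.2 = 0 := by
  set k' : C(Y × X, ℝ) := precompL ContinuousMap.prodSwap k with hk'
  set G : C(Y, ℝ) → C(Y, ℝ) := fun v => sinkhorn ν₀ k' (sinkhorn ν₁ k v) with hG
  have hc := contractionConst_nonneg k
  have hc' := contractionConst_nonneg k'
  have hl := contractionConst_lt_one k
  have hl' := contractionConst_lt_one k'
  -- Subtracting the mean changes no oscillation and gives increments of mean zero.
  obtain ⟨v, hv, -⟩ := existsUnique_fixedPoint ν₁
    (f := fun v => G v - (integralL ν₁ (G v)) • (1 : C(Y, ℝ)))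
    (κ := contractionConst k' * contractionConst k) (by positivity) (by nlinarith)
    (fun v w s hs => by
      have := oscLE_sinkhorn_sub ν₀ k' (oscLE_sinkhorn_sub ν₁ k hs)
      intro y y'
      have := this y y'
      simp only [ContinuousMap.sub_apply, ContinuousMap.smul_apply, ContinuousMap.one_apply,
        smul_eq_mul, mul_one, hG] at this ⊢
      linarith)
    (fun v w => by
      have : ∀ c : ℝ, integralL ν₁ (c • (1 : C(Y, ℝ))) = c := fun c => by simp
      simp only [map_sub, this]
      ring)
  set u := sinkhorn ν₁ k v with hu
  set b := integralL ν₁ (G v) with hb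
  have e₁ : partialIntegral X ν₁ (gibbs k (u, v)) = 1 := by
    ext x
    have hpos := integral_expMap_pos ν₁ (v + k.curry x)
    change ∫ y, Real.exp (u x + v y + k (x, y)) ∂ν₁ = 1
    simp only [add_assoc, Real.exp_add (u x), integral_const_mul]
    rw [hu, sinkhorn_apply, Real.exp_neg, Real.exp_log hpos]
    exact inv_mul_cancel₀ hpos.ne'
  have e₂ : partialIntegralFst ν₀ Y (gibbs k (u, v)) = Real.exp (-b) • (1 : C(Y, ℝ)) := by
    ext y
    have hpos := integral_expMap_pos ν₀ (u + k'.curry y)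
    have hy : G v y - b = v y := by simpa using DFunLike.congr_fun hv y
    change ∫ x, Real.exp (u x + v y + k (x, y)) ∂ν₀ = Real.exp (-b) * 1
    have : ∀ x, u x + v y + k (x, y) = -b + (G v y + (u + k'.curry y) x) := fun x => by
      rw [← hy]
      change _ = -b + (G v y + (u x + k (x, y)))
      ring
    simp only [this, Real.exp_add (-b), Real.exp_add (G v y), integral_const_mul]
    congr 1
    change Real.exp (sinkhorn ν₀ k' u y) * _ = 1
    rw [sinkhorn_apply, Real.exp_neg, Real.exp_log hpos]
    exact inv_mul_cancel₀ hpos.ne'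
  -- By Fubini, the mass of the Gibbs density is `1` through the first marginal and `exp (-b)`
  -- through the second.
  have hb0 : Real.exp (-b) = 1 := by
    have h := (integralL_partialIntegralFst ν₀ ν₁ (gibbs k (u, v))).trans
      (integralL_partialIntegral ν₀ ν₁ (gibbs k (u, v))).symm
    rw [e₁, e₂] at h
    simpa using h
  refine ⟨(u, v), ⟨e₁, by rw [e₂, hb0, one_smul]⟩, ?_⟩
  have h := congrArg (integralL ν₁) hv
  simp only [map_sub, ← hb] at h
  rw [← h]
  simp

/-- Well-posedness of the linearized system, with the gauge fixed by a mean value. -/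
theorem IsSchrodinger.existsUnique_linear (hw : IsSchrodinger ν₀ ν₁ k w) (g : C(X, ℝ) × C(Y, ℝ)) :
    ∃! h : C(X, ℝ) × C(Y, ℝ),
      (partialIntegral X ν₁ (gibbs k w * sumL h),
        partialIntegralFst ν₀ Y (gibbs k w * sumL h) + integralL ν₁ h.2 • (1 : C(Y, ℝ))) = g := by
  -- The system becomes `h₀ + P h₁ = g.1`, `Q h₀ + h₁ + mean h₁ = g.2`. Without the mean term, the
  -- pairs of constants `(a, -a)` would lie in the kernel and the range would contain only pairs of
  -- equal mean.
  set P : C(Y, ℝ) → C(X, ℝ) := fun h =>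
    partialIntegral X ν₁ (gibbs k w * precompL ContinuousMap.snd h) with hP
  set Q : C(X, ℝ) → C(Y, ℝ) := fun h =>
    partialIntegralFst ν₀ Y (gibbs k w * precompL ContinuousMap.fst h) with hQ
  have hPs : ∀ h h', P (h - h') = P h - P h' := fun h h' => by
    simp only [hP, map_sub, mul_sub]
  have hQs : ∀ h h', Q (h - h') = Q h - Q h' := fun h h' => by
    simp only [hQ, map_sub, mul_sub]
  have mP : ∀ h, integralL ν₀ (P h) = integralL ν₁ h := fun h => by
    conv_rhs => rw [← hw.partialIntegralFst_mul_snd h]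
    rw [integralL_partialIntegralFst, hP, integralL_partialIntegral]
  have mQ : ∀ h, integralL ν₁ (Q h) = integralL ν₀ h := fun h => by
    conv_rhs => rw [← hw.partialIntegral_mul_fst h]
    rw [integralL_partialIntegral, hQ, integralL_partialIntegralFst]
  have e : ∀ h : C(X, ℝ) × C(Y, ℝ),
      (partialIntegral X ν₁ (gibbs k w * sumL h),
        partialIntegralFst ν₀ Y (gibbs k w * sumL h) + integralL ν₁ h.2 • (1 : C(Y, ℝ))) =
      (h.1 + P h.2, Q h.1 + h.2 + integralL ν₁ h.2 • (1 : C(Y, ℝ))) := fun h => by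
    have : sumL h = precompL ContinuousMap.fst h.1 + precompL ContinuousMap.snd h.2 := rfl
    rw [this, mul_add, map_add, map_add, hw.partialIntegral_mul_fst,
      hw.partialIntegralFst_mul_snd]
  set k' : C(Y × X, ℝ) := precompL ContinuousMap.prodSwap k with hk'
  have hc := contractionConst_nonneg k
  have hc' := contractionConst_nonneg k'
  have hl := contractionConst_lt_one k
  have hl' := contractionConst_lt_one k'
  have oP : ∀ h s, OscLE h s → OscLE (P h) (contractionConst k * s) := fun h s hs =>
    oscLE_partialIntegral ν₁ k hw.integral_fst hs _ fun x => rfl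
  have oQ : ∀ h s, OscLE h s → OscLE (Q h) (contractionConst k' * s) := fun h s hs =>
    oscLE_partialIntegral ν₀ k' (u := w.2) (v := w.1)
      (fun y => by
        have := hw.integral_snd y
        simp only [add_comm (w.1 _)] at this
        exact this) hs _ fun y => by
        simp only [add_comm (w.2 y)]
        rfl
  -- Eliminating `h₀ = g.1 - P h₁` leaves this fixed-point equation for `h₁`. Since `P` and `Q`
  -- preserve means, subtracting the mean of `h` makes the increments have mean zero.
  obtain ⟨h, hh, hu⟩ := existsUnique_fixedPoint ν₁
    (f := fun h => Q (P h) - integralL ν₁ h • (1 : C(Y, ℝ)) + (g.2 - Q g.1))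
    (κ := contractionConst k' * contractionConst k) (by positivity) (by nlinarith)
    (fun v w s hs => by
      have := oQ _ _ (oP _ _ hs)
      rw [hPs, hQs] at this
      intro y y'
      have := this y y'
      simp only [ContinuousMap.sub_apply, ContinuousMap.smul_apply, ContinuousMap.one_apply,
        ContinuousMap.add_apply, smul_eq_mul, mul_one] at this ⊢
      linarith)
    (fun v w => by
      have : ∀ c : ℝ, integralL ν₁ (c • (1 : C(Y, ℝ))) = c := fun c => by simp
      simp only [map_sub, map_add, this, mQ, mP]
      ring)
  simp only [e]
  refine ⟨(g.1 - P h, h), ?_, ?_⟩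
  · refine Prod.ext (by simp) ?_
    simp only [hQs]
    nth_rewrite 2 [← hh]
    abel
  · rintro ⟨h₀, h₁⟩ hg
    obtain ⟨e₁, e₂⟩ := Prod.mk.inj hg
    simp only at e₁ e₂
    have e₃ : h₀ = g.1 - P h₁ := eq_sub_of_add_eq e₁
    have e₄ : h₁ = h := hu h₁ (by
      simp only
      rw [← e₂, e₃, hQs]
      abel)
    rw [e₃, e₄]

variable (ν₀ ν₁) in
/-- The left-hand side of the Schrödinger system, with a term which fixes the gauge. -/
def schrodingerMap (q : C(X × Y, ℝ) × (C(X, ℝ) × C(Y, ℝ))) : C(X, ℝ) × C(Y, ℝ) :=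
  ((partialIntegral X ν₁).prod (partialIntegralFst ν₀ Y)) (gibbs q.1 q.2) +
    ContinuousLinearMap.inr ℝ C(X, ℝ) C(Y, ℝ) (integralL ν₁ q.2.2 • (1 : C(Y, ℝ)))

theorem gibbs_eq_comp : (fun q : C(X × Y, ℝ) × (C(X, ℝ) × C(Y, ℝ)) => gibbs q.1 q.2) =
    expMap ∘ (sumL ∘L ContinuousLinearMap.snd ℝ C(X × Y, ℝ) (C(X, ℝ) × C(Y, ℝ)) +
      ContinuousLinearMap.fst ℝ C(X × Y, ℝ) (C(X, ℝ) × C(Y, ℝ))) := rfl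

theorem contDiff_gibbs {n : WithTop ℕ∞} :
    ContDiff ℝ n (fun q : C(X × Y, ℝ) × (C(X, ℝ) × C(Y, ℝ)) => gibbs q.1 q.2) := by
  rw [gibbs_eq_comp]
  exact contDiff_expMap.comp (ContinuousLinearMap.contDiff _)

theorem hasFDerivAt_gibbs (k : C(X × Y, ℝ)) (w : C(X, ℝ) × C(Y, ℝ)) :
    HasFDerivAt (fun q : C(X × Y, ℝ) × (C(X, ℝ) × C(Y, ℝ)) => gibbs q.1 q.2)
      ((gibbs k w • (1 : C(X × Y, ℝ) →L[ℝ] C(X × Y, ℝ))) ∘L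
        (sumL ∘L ContinuousLinearMap.snd ℝ _ _ + ContinuousLinearMap.fst ℝ _ _)) (k, w) := by
  rw [gibbs_eq_comp]
  exact (hasStrictFDerivAt_expMap _).hasFDerivAt.comp _ (ContinuousLinearMap.hasFDerivAt _)

theorem contDiff_schrodingerMap {n : WithTop ℕ∞} :
    ContDiff ℝ n (schrodingerMap (X := X) (Y := Y) ν₀ ν₁) :=
  ((ContinuousLinearMap.contDiff _).comp contDiff_gibbs).add
    ((ContinuousLinearMap.contDiff _).comp
      (((integralL ν₁).contDiff.comp (contDiff_snd.comp contDiff_snd)).smul contDiff_const))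

theorem fderiv_schrodingerMap_inr (k : C(X × Y, ℝ)) (w h : C(X, ℝ) × C(Y, ℝ)) :
    (fderiv ℝ (schrodingerMap ν₀ ν₁) (k, w) ∘L ContinuousLinearMap.inr ℝ _ _) h =
      (partialIntegral X ν₁ (gibbs k w * sumL h),
        partialIntegralFst ν₀ Y (gibbs k w * sumL h) + integralL ν₁ h.2 • (1 : C(Y, ℝ))) := by
  have h₁ := ((partialIntegral X ν₁).prod (partialIntegralFst ν₀ Y)).hasFDerivAt.comp _
    (hasFDerivAt_gibbs k w)
  have h₂ := (ContinuousLinearMap.inr ℝ C(X, ℝ) C(Y, ℝ) ∘L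
    ((integralL ν₁ ∘L ContinuousLinearMap.snd ℝ C(X, ℝ) C(Y, ℝ) ∘L
      ContinuousLinearMap.snd ℝ C(X × Y, ℝ) _).smulRight (1 : C(Y, ℝ)))).hasFDerivAt (x := (k, w))
  have h₃ : HasFDerivAt (schrodingerMap ν₀ ν₁) _ (k, w) := h₁.add h₂
  rw [h₃.fderiv]
  refine Prod.ext ?_ ?_ <;> simp [smul_eq_mul]

/-- Smooth dependence of the solution of the Schrödinger system on the exponent. -/
theorem IsSchrodinger.exists_contDiffAt (hw : IsSchrodinger ν₀ ν₁ k w)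
    (h0 : integralL ν₁ w.2 = 0) :
    ∃ g : C(X × Y, ℝ) → C(X, ℝ) × C(Y, ℝ), ContDiffAt ℝ ∞ g k ∧ g k = w ∧
      ∀ᶠ k' in nhds k, IsSchrodinger ν₀ ν₁ k' (g k') := by
  have hF : ContDiffAt ℝ ∞ (schrodingerMap ν₀ ν₁) (k, w) :=
    contDiff_schrodingerMap.contDiffAt
  have hn : (∞ : WithTop ℕ∞) ≠ 0 := by simp
  have hbij : Function.Bijective
      (fderiv ℝ (schrodingerMap ν₀ ν₁) (k, w) ∘L ContinuousLinearMap.inr ℝ _ _) := by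
    rw [Function.bijective_iff_existsUnique]
    intro g
    simp only [fderiv_schrodingerMap_inr]
    exact hw.existsUnique_linear g
  have hinv : (fderiv ℝ (schrodingerMap ν₀ ν₁) (k, w) ∘L
      ContinuousLinearMap.inr ℝ _ _).IsInvertible :=
    ⟨ContinuousLinearEquiv.ofBijective _ (LinearMap.ker_eq_bot.2 hbij.1)
      (LinearMap.range_eq_top.2 hbij.2), ContinuousLinearEquiv.coe_ofBijective _ _ _⟩
  refine ⟨hF.implicitFunction hn hinv, hF.contDiffAt_implicitFunction hn hinv,
    hF.implicitFunction_apply_self hn hinv, ?_⟩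
  filter_upwards [hF.eventually_apply_implicitFunction hn hinv] with k' hk'
  set w' := hF.implicitFunction hn hinv k'
  have e : schrodingerMap ν₀ ν₁ (k, w) = (1, 1) := by
    simp only [schrodingerMap, ContinuousLinearMap.prod_apply, hw.1, hw.2, h0]
    simp
  rw [e] at hk'
  have e₁ : partialIntegral X ν₁ (gibbs k' w') = 1 := by
    simpa [schrodingerMap] using congrArg Prod.fst hk'
  have e₂ : partialIntegralFst ν₀ Y (gibbs k' w') + integralL ν₁ w'.2 • (1 : C(Y, ℝ)) = 1 := by
    simpa [schrodingerMap] using congrArg Prod.snd hk'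
  -- The first equation fixes the total mass at one, so integrating the second shows that the gauge
  -- term vanishes and the original system is recovered.
  have e₃ : integralL ν₁ w'.2 = 0 := by
    have h₁ := integralL_partialIntegral ν₀ ν₁ (gibbs k' w')
    have h₂ := congrArg (integralL ν₁) e₂
    rw [map_add, integralL_partialIntegralFst, ← h₁, e₁, map_smul] at h₂
    simpa using h₂
  rw [e₃, zero_smul, add_zero] at e₂
  exact ⟨e₁, e₂⟩

/-- The derivative of a family of solutions of the Schrödinger system solves the linearized
system. -/
theorem isLinSchrodinger_of_hasFDerivAt {g : C(X × Y, ℝ) → C(X, ℝ) × C(Y, ℝ)}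
    {g' : C(X × Y, ℝ) →L[ℝ] C(X, ℝ) × C(Y, ℝ)} (hg : HasFDerivAt g g' k)
    (hs : ∀ᶠ k' in nhds k, IsSchrodinger ν₀ ν₁ k' (g k')) (κ : C(X × Y, ℝ)) :
    IsLinSchrodinger ν₀ ν₁ k (g k) κ (g' κ) := by
  have h := (hasFDerivAt_gibbs k (g k)).comp k ((hasFDerivAt_id k).prodMk hg)
  constructor
  · have h₁ := (partialIntegral X ν₁).hasFDerivAt.comp k h
    have h₂ : HasFDerivAt (fun _ => (1 : C(X, ℝ))) (0 : C(X × Y, ℝ) →L[ℝ] C(X, ℝ)) k :=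
      hasFDerivAt_const _ _
    have h₃ := h₁.unique (h₂.congr_of_eventuallyEq (hs.mono fun k' hk' => hk'.1))
    simpa [smul_eq_mul, mul_add] using DFunLike.congr_fun h₃ κ
  · have h₁ := (partialIntegralFst ν₀ Y).hasFDerivAt.comp k h
    have h₂ : HasFDerivAt (fun _ => (1 : C(Y, ℝ))) (0 : C(X × Y, ℝ) →L[ℝ] C(Y, ℝ)) k :=
      hasFDerivAt_const _ _
    have h₃ := h₁.unique (h₂.congr_of_eventuallyEq (hs.mono fun k' hk' => hk'.2))
    simpa [smul_eq_mul, mul_add] using DFunLike.congr_fun h₃ κ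

/-- Integrate the first linearized equation: the unit marginals reduce the terms in `h` to plain
means. The left side is the derivative of the dual value, so no knowledge of `h` is needed for the
first derivative. -/
theorem IsLinSchrodinger.integral_add_integral {κ : C(X × Y, ℝ)} {h : C(X, ℝ) × C(Y, ℝ)}
    (hw : IsSchrodinger ν₀ ν₁ k w) (hh : IsLinSchrodinger ν₀ ν₁ k w κ h) :
    integralL ν₀ h.1 + integralL ν₁ h.2 = -∫ z, gibbs k w z * κ z ∂ν₀.prod ν₁ := by
  have e₁ := integralL_partialIntegral ν₀ ν₁ (gibbs k w * (sumL h + κ))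
  rw [hh.1, map_zero] at e₁
  have e₂ := integralL_partialIntegral ν₀ ν₁ (gibbs k w * precompL ContinuousMap.fst h.1)
  rw [hw.partialIntegral_mul_fst] at e₂
  have e₃ := integralL_partialIntegralFst ν₀ ν₁ (gibbs k w * precompL ContinuousMap.snd h.2)
  rw [hw.partialIntegralFst_mul_snd] at e₃
  have e₄ : gibbs k w * (sumL h + κ) = gibbs k w * precompL ContinuousMap.fst h.1 +
      gibbs k w * precompL ContinuousMap.snd h.2 + gibbs k w * κ := by
    rw [← mul_add, ← mul_add]
    rfl
  have e₅ : ∀ f : C(X × Y, ℝ), ∫ z, f z ∂ν₀.prod ν₁ = integralL (ν₀.prod ν₁) f := fun _ => rfl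
  rw [e₄, e₅, map_add, map_add, ← e₅, ← e₅, ← e₂, ← e₃] at e₁
  have e₆ : ∫ z, gibbs k w z * κ z ∂ν₀.prod ν₁ = integralL (ν₀.prod ν₁) (gibbs k w * κ) := rfl
  rw [e₆]
  linarith

/-- Solutions of the linearized system are unique up to an additive constant. -/
theorem IsLinSchrodinger.unique {κ : C(X × Y, ℝ)} {h h' : C(X, ℝ) × C(Y, ℝ)}
    (hw : IsSchrodinger ν₀ ν₁ k w) (hh : IsLinSchrodinger ν₀ ν₁ k w κ h)
    (hh' : IsLinSchrodinger ν₀ ν₁ k w κ h') :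
    ∃ a : ℝ, (∀ x, h'.1 x = h.1 x + a) ∧ ∀ y, h'.2 y = h.2 y - a := by
  -- This shift gives the second component of `d` mean zero, so `d` solves the homogeneous system
  -- with the gauge term and must vanish.
  set a := integralL ν₁ (h.2 - h'.2) with ha
  set d : C(X, ℝ) × C(Y, ℝ) := h' - h + (-a • (1 : C(X, ℝ)), a • (1 : C(Y, ℝ))) with hd
  have hs : sumL d = sumL h' - sumL h := by
    ext z
    simp [hd]
  have e : gibbs k w * sumL d = gibbs k w * (sumL h' + κ) - gibbs k w * (sumL h + κ) := by
    rw [hs]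
    ring
  have hd0 : integralL ν₁ d.2 = 0 := by
    have : d.2 = a • (1 : C(Y, ℝ)) - (h.2 - h'.2) := by
      simp [hd]
      abel
    rw [this, map_sub, ← ha]
    simp
  have h₀ : d = 0 := (hw.existsUnique_linear 0).unique
    (by simp only [e, map_sub, hh.1, hh.2, hh'.1, hh'.2, hd0]; simp)
    (by simp)
  refine ⟨a, fun x => ?_, fun y => ?_⟩
  · have := DFunLike.congr_fun (congrArg Prod.fst h₀) x
    simp [hd] at this
    linarith
  · have := DFunLike.congr_fun (congrArg Prod.snd h₀) y
    simp [hd] at this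
    linarith

end

end EntropicTransport

/-! ### Duality: the Gibbs coupling and the entropic objective. -/

namespace EntropicTransport

noncomputable section

variable {X Y : Type*} [TopologicalSpace X] [T2Space X] [SecondCountableTopology X]
  [MeasurableSpace X] [BorelSpace X] [TopologicalSpace Y] [T2Space Y] [SecondCountableTopology Y]
  [MeasurableSpace Y] [BorelSpace Y]
  {μ₀ : Measure X} {μ₁ : Measure Y} [IsProbabilityMeasure μ₀] [IsProbabilityMeasure μ₁]

theorem isProbabilityMeasure_of_mem_couplings {π : Measure (X × Y)} (hπ : π ∈ couplings μ₀ μ₁) :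
    IsProbabilityMeasure π := by
  have : IsProbabilityMeasure (π.map Prod.fst) := by rw [hπ.1]; infer_instance
  exact Measure.isProbabilityMeasure_of_map Prod.fst

theorem prod_mem_couplings : μ₀.prod μ₁ ∈ couplings μ₀ μ₁ := by
  constructor <;> simp [Measure.map_fst_prod, Measure.map_snd_prod]

theorem ae_mem_support_of_mem_couplings {π : Measure (X × Y)} (hπ : π ∈ couplings μ₀ μ₁) :
    ∀ᵐ z ∂π, z ∈ μ₀.support ×ˢ μ₁.support := by
  have h₀ : ∀ᵐ x ∂π.map Prod.fst, x ∈ μ₀.support := by rw [hπ.1]; exact Measure.support_mem_ae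
  have h₁ : ∀ᵐ y ∂π.map Prod.snd, y ∈ μ₁.support := by rw [hπ.2]; exact Measure.support_mem_ae
  filter_upwards [ae_of_ae_map measurable_fst.aemeasurable h₀,
    ae_of_ae_map measurable_snd.aemeasurable h₁] with z hz₀ hz₁ using ⟨hz₀, hz₁⟩

theorem integrable_of_mem_couplings (h₀ : IsCompact μ₀.support) (h₁ : IsCompact μ₁.support)
    {π : Measure (X × Y)} (hπ : π ∈ couplings μ₀ μ₁) {f : X × Y → ℝ} (hf : Continuous f) :
    Integrable f π := by
  have := isProbabilityMeasure_of_mem_couplings hπ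
  have hm : MeasurableSet (μ₀.support ×ˢ μ₁.support) := (h₀.prod h₁).measurableSet
  have h := hf.continuousOn.integrableOn_compact' (μ := π) (h₀.prod h₁) hm
  rwa [IntegrableOn, Measure.restrict_eq_self_of_ae_mem (ae_mem_support_of_mem_couplings hπ)] at h

theorem integral_comp_fst {π : Measure (X × Y)} (hπ : π ∈ couplings μ₀ μ₁) {f : X → ℝ}
    (hf : StronglyMeasurable f) : ∫ z, f z.1 ∂π = ∫ x, f x ∂μ₀ := by
  rw [← hπ.1, integral_map measurable_fst.aemeasurable hf.aestronglyMeasurable]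

theorem integral_comp_snd {π : Measure (X × Y)} (hπ : π ∈ couplings μ₀ μ₁) {f : Y → ℝ}
    (hf : StronglyMeasurable f) : ∫ z, f z.2 ∂π = ∫ y, f y ∂μ₁ := by
  rw [← hπ.2, integral_map measurable_snd.aemeasurable hf.aestronglyMeasurable]

/-- The exponent of the Gibbs density of a pair of potentials. -/
def gibbsExponent (c : X → Y → ℝ) (ε : ℝ) (φ₀ : X → ℝ) (φ₁ : Y → ℝ) (z : X × Y) : ℝ :=
  (φ₀ z.1 + φ₁ z.2 - c z.1 z.2) / ε

variable {c : X → Y → ℝ} {ε : ℝ} {φ₀ : X → ℝ} {φ₁ : Y → ℝ}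

theorem continuous_gibbsExponent (hc : Continuous (Function.uncurry c))
    (hφ : IsEOTPotentials μ₀ μ₁ c ε φ₀ φ₁) : Continuous (gibbsExponent c ε φ₀ φ₁) :=
  (((hφ.continuous_fst.comp continuous_fst).add (hφ.continuous_snd.comp continuous_snd)).sub
    hc).div_const ε

theorem integral_exp_gibbsExponent (h₀ : IsCompact μ₀.support) (h₁ : IsCompact μ₁.support)
    (hc : Continuous (Function.uncurry c)) (hφ : IsEOTPotentials μ₀ μ₁ c ε φ₀ φ₁) :
    ∫ z, Real.exp (gibbsExponent c ε φ₀ φ₁ z) ∂μ₀.prod μ₁ = 1 := by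
  have h : Integrable (fun z => Real.exp (gibbsExponent c ε φ₀ φ₁ z)) (μ₀.prod μ₁) :=
    integrable_of_mem_couplings h₀ h₁ prod_mem_couplings
      (Real.continuous_exp.comp (continuous_gibbsExponent hc hφ))
  rw [integral_prod _ h]
  simp [gibbsExponent, hφ.system_fst]

theorem lintegral_ofReal_exp_eq_one {Z : Type*} [MeasurableSpace Z] {μ : Measure Z} {f : Z → ℝ}
    (hf : ∫ z, Real.exp (f z) ∂μ = 1) : ∫⁻ z, ENNReal.ofReal (Real.exp (f z)) ∂μ = 1 := by
  rw [← ofReal_integral_eq_lintegral_ofReal (.of_integral_ne_zero (by simp [hf]))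
    (ae_of_all _ fun z => (Real.exp_pos _).le), hf, ENNReal.ofReal_one]

variable (μ₀ μ₁ c ε φ₀ φ₁) in
/-- The coupling with the Gibbs density of a pair of potentials. -/
def gibbsCoupling : Measure (X × Y) := (μ₀.prod μ₁).tilted (gibbsExponent c ε φ₀ φ₁)

theorem gibbsCoupling_mem_couplings (h₀ : IsCompact μ₀.support) (h₁ : IsCompact μ₁.support)
    (hc : Continuous (Function.uncurry c)) (hφ : IsEOTPotentials μ₀ μ₁ c ε φ₀ φ₁) :
    gibbsCoupling μ₀ μ₁ c ε φ₀ φ₁ ∈ couplings μ₀ μ₁ := by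
  have hm : Measurable fun z => ENNReal.ofReal (Real.exp (gibbsExponent c ε φ₀ φ₁ z)) :=
    (Real.continuous_exp.comp (continuous_gibbsExponent hc hφ)).measurable.ennreal_ofReal
  constructor
  · ext s hs
    rw [Measure.map_apply measurable_fst hs, gibbsCoupling,
      tilted_apply' _ _ (measurable_fst hs), ← Set.prod_univ, ← Measure.prod_restrict]
    simp only [integral_exp_gibbsExponent h₀ h₁ hc hφ, div_one]
    rw [lintegral_prod _ hm.aemeasurable, Measure.restrict_univ]
    have : ∀ x, ∫⁻ y, ENNReal.ofReal (Real.exp (gibbsExponent c ε φ₀ φ₁ (x, y))) ∂μ₁ = 1 :=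
      fun x => lintegral_ofReal_exp_eq_one (hφ.system_fst x)
    simp [this]
  · ext s hs
    rw [Measure.map_apply measurable_snd hs, gibbsCoupling,
      tilted_apply' _ _ (measurable_snd hs), ← Set.univ_prod, ← Measure.prod_restrict]
    simp only [integral_exp_gibbsExponent h₀ h₁ hc hφ, div_one]
    rw [lintegral_prod_symm _ hm.aemeasurable, Measure.restrict_univ]
    have : ∀ y, ∫⁻ x, ENNReal.ofReal (Real.exp (gibbsExponent c ε φ₀ φ₁ (x, y))) ∂μ₀ = 1 :=
      fun y => lintegral_ofReal_exp_eq_one (hφ.system_snd y)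
    simp [this]

theorem integral_gibbsCoupling (h₀ : IsCompact μ₀.support) (h₁ : IsCompact μ₁.support)
    (hc : Continuous (Function.uncurry c)) (hφ : IsEOTPotentials μ₀ μ₁ c ε φ₀ φ₁)
    (f : X × Y → ℝ) :
    ∫ z, f z ∂gibbsCoupling μ₀ μ₁ c ε φ₀ φ₁ =
      ∫ z, Real.exp (gibbsExponent c ε φ₀ φ₁ z) * f z ∂μ₀.prod μ₁ := by
  rw [gibbsCoupling, integral_tilted]
  simp [integral_exp_gibbsExponent h₀ h₁ hc hφ]

/-- The entropic transport objective, relative to the Gibbs coupling. -/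
theorem eotObjective_eq (h₀ : IsCompact μ₀.support) (h₁ : IsCompact μ₁.support)
    (hc : Continuous (Function.uncurry c)) (hε : 0 < ε)
    (hφ : IsEOTPotentials μ₀ μ₁ c ε φ₀ φ₁) {π : Measure (X × Y)} (hπ : π ∈ couplings μ₀ μ₁) :
    eotObjective μ₀ μ₁ c ε π = ((∫ x, φ₀ x ∂μ₀ + ∫ y, φ₁ y ∂μ₁ : ℝ) : EReal) +
      (ε : EReal) * (klDiv π (gibbsCoupling μ₀ μ₁ c ε φ₀ φ₁) : EReal) := by
  have := isProbabilityMeasure_of_mem_couplings hπ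
  have hγ := gibbsCoupling_mem_couplings h₀ h₁ hc hφ
  have := isProbabilityMeasure_of_mem_couplings hγ
  set f := gibbsExponent c ε φ₀ φ₁ with hf
  have hfc : Continuous f := continuous_gibbsExponent hc hφ
  have hexp : Integrable (fun z => Real.exp (f z)) (μ₀.prod μ₁) :=
    integrable_of_mem_couplings h₀ h₁ prod_mem_couplings (Real.continuous_exp.comp hfc)
  have hfi : Integrable f π := integrable_of_mem_couplings h₀ h₁ hπ hfc
  have hZ : ∫ z, Real.exp (f z) ∂μ₀.prod μ₁ = 1 := integral_exp_gibbsExponent h₀ h₁ hc hφ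
  have hac : π ≪ gibbsCoupling μ₀ μ₁ c ε φ₀ φ₁ ↔ π ≪ μ₀.prod μ₁ :=
    ⟨fun h => h.trans (tilted_absolutelyContinuous _ _),
      fun h => h.trans (absolutelyContinuous_tilted hexp)⟩
  -- A coupling sees the potentials only through its marginals, so their contribution is the same
  -- for every `π`.
  have hint : (∫ z, f z ∂π) * ε = ∫ x, φ₀ x ∂μ₀ + ∫ y, φ₁ y ∂μ₁ - ∫ z, c z.1 z.2 ∂π := by
    have i₀ : Integrable (fun z : X × Y => φ₀ z.1) π :=
      integrable_of_mem_couplings h₀ h₁ hπ (hφ.continuous_fst.comp continuous_fst)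
    have i₁ : Integrable (fun z : X × Y => φ₁ z.2) π :=
      integrable_of_mem_couplings h₀ h₁ hπ (hφ.continuous_snd.comp continuous_snd)
    have i₂ : Integrable (fun z : X × Y => φ₀ z.1 + φ₁ z.2) π := i₀.add i₁
    have ic : Integrable (fun z : X × Y => c z.1 z.2) π :=
      integrable_of_mem_couplings h₀ h₁ hπ hc
    rw [← integral_mul_const, ← integral_comp_fst hπ hφ.continuous_fst.stronglyMeasurable,
      ← integral_comp_snd hπ hφ.continuous_snd.stronglyMeasurable, ← integral_add i₀ i₁,
      ← integral_sub i₂ ic]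
    refine integral_congr_ae (ae_of_all _ fun z => ?_)
    simp only [hf, gibbsExponent]
    exact div_mul_cancel₀ _ hε.ne'
  have htop : ∀ r : ℝ, (r : EReal) + (ε : EReal) * ((⊤ : ENNReal) : EReal) = ⊤ := fun r => by
    rw [EReal.coe_ennreal_top, EReal.coe_mul_top_of_pos hε, EReal.coe_add_top]
  unfold eotObjective
  -- The log-likelihood ratios relative to the product and to the Gibbs coupling differ by the
  -- integrable function `f`, so both divergences are finite together; otherwise both sides are `⊤`.
  by_cases h : π ≪ μ₀.prod μ₁
  · have hllr := llr_tilted_right h hexp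
    rw [hZ, Real.log_one] at hllr
    simp only [add_zero] at hllr
    by_cases hi : Integrable (llr π (μ₀.prod μ₁)) π
    · have hi' : Integrable (llr π (gibbsCoupling μ₀ μ₁ c ε φ₀ φ₁)) π :=
        integrable_llr_tilted_right h hfi hi hexp
      have hI := integral_llr_tilted_right h hfi hexp hi
      rw [hZ, Real.log_one, add_zero] at hI
      rw [← EReal.coe_ennreal_toReal (klDiv_ne_top h hi),
        ← EReal.coe_ennreal_toReal (klDiv_ne_top (hac.2 h) hi'),
        toReal_klDiv_of_measure_eq h (by simp), toReal_klDiv_of_measure_eq (hac.2 h) (by simp)]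
      norm_cast
      rw [show ∫ z, llr π (gibbsCoupling μ₀ μ₁ c ε φ₀ φ₁) z ∂π = _ from hI]
      linarith
    · have hi' : ¬ Integrable (llr π (gibbsCoupling μ₀ μ₁ c ε φ₀ φ₁)) π := fun hi' => hi <| by
        refine (hi'.add hfi).congr ?_
        filter_upwards [hllr] with z hz
        simp only [Pi.add_apply]
        rw [show llr π (gibbsCoupling μ₀ μ₁ c ε φ₀ φ₁) z = _ from hz]
        ring
      rw [klDiv_of_not_integrable hi, klDiv_of_not_integrable hi', htop, htop]
  · rw [klDiv_of_not_ac h, klDiv_of_not_ac (fun h' => h (hac.1 h')), htop, htop]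

/-- Strong duality. -/
theorem eotCost_eq (h₀ : IsCompact μ₀.support) (h₁ : IsCompact μ₁.support)
    (hc : Continuous (Function.uncurry c)) (hε : 0 < ε)
    (hφ : IsEOTPotentials μ₀ μ₁ c ε φ₀ φ₁) :
    eotCost μ₀ μ₁ c ε = ((∫ x, φ₀ x ∂μ₀ + ∫ y, φ₁ y ∂μ₁ : ℝ) : EReal) := by
  have hγ := gibbsCoupling_mem_couplings h₀ h₁ hc hφ
  have := isProbabilityMeasure_of_mem_couplings hγ
  refine le_antisymm ((iInf₂_le _ hγ).trans ?_) (le_iInf₂ fun π hπ => ?_)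
  · rw [eotObjective_eq h₀ h₁ hc hε hφ hγ, klDiv_self]
    simp
  · rw [eotObjective_eq h₀ h₁ hc hε hφ hπ]
    exact le_add_of_nonneg_right
      (mul_nonneg (EReal.coe_nonneg.2 hε.le) (EReal.coe_ennreal_nonneg _))

/-- The excess of the objective over the dual value is `ε` times a divergence, which vanishes only
at the Gibbs coupling. -/
theorem isEOTCoupling_iff (h₀ : IsCompact μ₀.support) (h₁ : IsCompact μ₁.support)
    (hc : Continuous (Function.uncurry c)) (hε : 0 < ε)
    (hφ : IsEOTPotentials μ₀ μ₁ c ε φ₀ φ₁) {π : Measure (X × Y)} :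
    IsEOTCoupling μ₀ μ₁ c ε π ↔ π = gibbsCoupling μ₀ μ₁ c ε φ₀ φ₁ := by
  have hγ := gibbsCoupling_mem_couplings h₀ h₁ hc hφ
  have := isProbabilityMeasure_of_mem_couplings hγ
  constructor
  · rintro ⟨hπ, h⟩
    have := isProbabilityMeasure_of_mem_couplings hπ
    rw [eotObjective_eq h₀ h₁ hc hε hφ hπ, eotCost_eq h₀ h₁ hc hε hφ] at h
    rw [← klDiv_eq_zero_iff]
    by_contra hne
    have hpos : (0 : EReal) <
        (ε : EReal) * (klDiv π (gibbsCoupling μ₀ μ₁ c ε φ₀ φ₁) : EReal) :=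
      EReal.mul_pos (EReal.coe_pos.2 hε) (EReal.coe_ennreal_pos.2 (pos_iff_ne_zero.2 hne))
    have := EReal.add_lt_add_left_coe hpos (∫ x, φ₀ x ∂μ₀ + ∫ y, φ₁ y ∂μ₁)
    rw [h, add_zero] at this
    exact lt_irrefl _ this
  · rintro rfl
    refine ⟨hγ, ?_⟩
    rw [eotObjective_eq h₀ h₁ hc hε hφ hγ, eotCost_eq h₀ h₁ hc hε hφ, klDiv_self]
    simp

end

end EntropicTransport

/-! ### Derivatives of the value for an exponent affine in a parameter. -/

namespace EntropicTransport

noncomputable section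

variable {X Y : Type*} [TopologicalSpace X] [CompactSpace X] [TopologicalSpace Y] [CompactSpace Y]
  [SecondCountableTopology X] [SecondCountableTopology Y]
  [MeasurableSpace X] [BorelSpace X] [MeasurableSpace Y] [BorelSpace Y]
  {ν₀ : Measure X} {ν₁ : Measure Y} [IsProbabilityMeasure ν₀] [IsProbabilityMeasure ν₁]
  {k : C(X × Y, ℝ)} {w : C(X, ℝ) × C(Y, ℝ)}

/-- A solution of the Schrödinger system can be shifted so that its second component has mean
zero, without changing the Gibbs density. -/
theorem exists_gibbs_eq (ν₁ : Measure Y) [IsProbabilityMeasure ν₁] (k : C(X × Y, ℝ))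
    (w : C(X, ℝ) × C(Y, ℝ)) : ∃ w', gibbs k w' = gibbs k w ∧ integralL ν₁ w'.2 = 0 := by
  refine ⟨w + (integralL ν₁ w.2 • (1 : C(X, ℝ)), -integralL ν₁ w.2 • (1 : C(Y, ℝ))), ?_, ?_⟩
  · ext z
    simp only [gibbs_apply, Prod.fst_add, Prod.snd_add, ContinuousMap.add_apply,
      ContinuousMap.smul_apply, ContinuousMap.one_apply, smul_eq_mul, mul_one]
    congr 1
    ring
  · rw [Prod.snd_add, map_add, map_smul]
    simp

/-- Differentiating the implicit solution branch produces a solution. The branch needs the mean-zero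
gauge, but the linearized system sees `w` only through the Gibbs density. -/
theorem IsSchrodinger.exists_isLinSchrodinger (hw : IsSchrodinger ν₀ ν₁ k w) (κ : C(X × Y, ℝ)) :
    ∃ h, IsLinSchrodinger ν₀ ν₁ k w κ h := by
  obtain ⟨w', hg, h0⟩ := exists_gibbs_eq ν₁ k w
  have hw' : IsSchrodinger ν₀ ν₁ k w' := by rwa [IsSchrodinger, hg]
  obtain ⟨g, hgs, hgw, he⟩ := hw'.exists_contDiffAt h0
  have := isLinSchrodinger_of_hasFDerivAt
    (hgs.differentiableAt (by simp)).hasFDerivAt he κ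
  rw [hgw] at this
  exact ⟨_, by rwa [IsLinSchrodinger, hg] at this⟩

section Value

variable {E : Type*} [NormedAddCommGroup E] [NormedSpace ℝ E] {k₀ : C(X × Y, ℝ)}
  {L : E →L[ℝ] C(X × Y, ℝ)} {V : E → ℝ}

theorem hasFDerivAt_exponent (A : E) : HasFDerivAt (fun A => k₀ + L A) L A :=
  L.hasFDerivAt.const_add k₀

theorem eventually_value_eq
    (hV : ∀ A w, IsSchrodinger ν₀ ν₁ (k₀ + L A) w → V A = integralL ν₀ w.1 + integralL ν₁ w.2)
    {A : E} {g : C(X × Y, ℝ) → C(X, ℝ) × C(Y, ℝ)}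
    (hs : ∀ᶠ k' in nhds (k₀ + L A), IsSchrodinger ν₀ ν₁ k' (g k')) :
    V =ᶠ[nhds A] fun A => (integralL ν₀).coprod (integralL ν₁) (g (k₀ + L A)) := by
  have hc : Tendsto (fun A => k₀ + L A) (nhds A) (nhds (k₀ + L A)) :=
    (hasFDerivAt_exponent A).continuousAt
  exact (hc.eventually hs).mono fun A' hA' => hV A' _ hA'

/-- Local smooth branches suffice: `hV` allows any solution to compute `V`, so branches need not be
glued. -/
theorem contDiff_value
    (hV : ∀ A w, IsSchrodinger ν₀ ν₁ (k₀ + L A) w → V A = integralL ν₀ w.1 + integralL ν₁ w.2) :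
    ContDiff ℝ ∞ V := by
  rw [contDiff_iff_contDiffAt]
  intro A
  obtain ⟨w, hw, h0⟩ := exists_isSchrodinger (ν₀ := ν₀) (ν₁ := ν₁) (k₀ + L A)
  obtain ⟨g, hg, -, he⟩ := hw.exists_contDiffAt h0
  refine ContDiffAt.congr_of_eventuallyEq ?_ (eventually_value_eq hV he)
  exact (ContinuousLinearMap.contDiff _).contDiffAt.comp A
    (hg.comp A (contDiff_const.add L.contDiff).contDiffAt)

/-- The first derivative of the value of the dual problem. -/
theorem fderiv_value
    (hV : ∀ A w, IsSchrodinger ν₀ ν₁ (k₀ + L A) w → V A = integralL ν₀ w.1 + integralL ν₁ w.2)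
    {A : E} {w : C(X, ℝ) × C(Y, ℝ)} (hw : IsSchrodinger ν₀ ν₁ (k₀ + L A) w) (B : E) :
    fderiv ℝ V A B = -integralL (ν₀.prod ν₁) (gibbs (k₀ + L A) w * L B) := by
  obtain ⟨w', hgw, h0⟩ := exists_gibbs_eq ν₁ (k₀ + L A) w
  have hw' : IsSchrodinger ν₀ ν₁ (k₀ + L A) w' := by rwa [IsSchrodinger, hgw]
  obtain ⟨g, hg, hg0, he⟩ := hw'.exists_contDiffAt h0
  have hd := (hg.differentiableAt (by simp)).hasFDerivAt
  have hk : HasFDerivAt (fun A => k₀ + L A) L A := hasFDerivAt_exponent A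
  have h₁ := ((integralL ν₀).coprod (integralL ν₁)).hasFDerivAt.comp A (HasFDerivAt.comp A hd hk)
  rw [(h₁.congr_of_eventuallyEq (eventually_value_eq hV he)).fderiv]
  have h₂ := isLinSchrodinger_of_hasFDerivAt hd he (L B)
  rw [hg0] at h₂
  have h₃ := h₂.integral_add_integral hw'
  rw [hgw] at h₃
  exact h₃

/-- The second derivative of the value of the dual problem. -/
theorem fderiv_fderiv_value
    (hV : ∀ A w, IsSchrodinger ν₀ ν₁ (k₀ + L A) w → V A = integralL ν₀ w.1 + integralL ν₁ w.2)
    {A : E} {w : C(X, ℝ) × C(Y, ℝ)} (hw : IsSchrodinger ν₀ ν₁ (k₀ + L A) w) (B C : E)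
    {h : C(X, ℝ) × C(Y, ℝ)} (hh : IsLinSchrodinger ν₀ ν₁ (k₀ + L A) w (L C) h) :
    fderiv ℝ (fderiv ℝ V) A B C =
      -integralL (ν₀.prod ν₁) (gibbs (k₀ + L A) w * (sumL h + L C) * L B) := by
  have hsymm : IsSymmSndFDerivAt ℝ V A :=
    (contDiff_value hV).contDiffAt.isSymmSndFDerivAt
      (by simpa using WithTop.coe_le_coe.2 (le_top : (2 : ℕ∞) ≤ ⊤))
  -- The computation below differentiates `A' ↦ DV(A')(B)` in the direction `C`, which is the
  -- opposite order of arguments.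
  rw [hsymm.eq B C]
  obtain ⟨w', hgw, h0⟩ := exists_gibbs_eq ν₁ (k₀ + L A) w
  have hw' : IsSchrodinger ν₀ ν₁ (k₀ + L A) w' := by rwa [IsSchrodinger, hgw]
  obtain ⟨g, hg, hg0, he⟩ := hw'.exists_contDiffAt h0
  have hd := (hg.differentiableAt (by simp)).hasFDerivAt
  have hc : Tendsto (fun A => k₀ + L A) (nhds A) (nhds (k₀ + L A)) :=
    (hasFDerivAt_exponent A).continuousAt
  have hd₁ : HasFDerivAt (fderiv ℝ V) (fderiv ℝ (fderiv ℝ V) A) A :=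
    (((contDiff_value hV).fderiv_right (m := 1)
      (WithTop.coe_le_coe.2 (le_top : (2 : ℕ∞) ≤ ⊤))).differentiable one_ne_zero A).hasFDerivAt
  have hd₂ : HasFDerivAt (fun A' => fderiv ℝ V A' B) ((fderiv ℝ (fderiv ℝ V) A).flip B) A :=
    (ContinuousLinearMap.apply ℝ ℝ B).hasFDerivAt.comp A hd₁
  have hk : HasFDerivAt (fun A => k₀ + L A) L A := hasFDerivAt_exponent A
  have hG := HasFDerivAt.comp A (hasFDerivAt_gibbs (k₀ + L A) (g (k₀ + L A)))
    (hk.prodMk (HasFDerivAt.comp A hd hk))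
  have hd₃ := ((integralL (ν₀.prod ν₁)).hasFDerivAt.comp A (hG.mul_const (L B))).neg
  have heq : (fun A' => fderiv ℝ V A' B) =ᶠ[nhds A] _ :=
    (hc.eventually he).mono fun A' hA' => fderiv_value hV hA' B
  have e := DFunLike.congr_fun (hd₂.unique (hd₃.congr_of_eventuallyEq heq)) C
  have hlin := isLinSchrodinger_of_hasFDerivAt hd he (L C)
  rw [IsLinSchrodinger, hg0, hgw] at hlin
  obtain ⟨a, ha₀, ha₁⟩ := IsLinSchrodinger.unique hw hh hlin
  -- The given `h` and the derivative of the branch differ by a gauge `(a, -a)`, which the sum does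
  -- not see.
  have hsum : sumL (fderiv ℝ g (k₀ + L A) (L C)) = sumL h := by
    ext z
    simp only [sumL_apply, ha₀, ha₁]
    ring
  refine e.trans ?_
  rw [← hsum, ← hgw, ← hg0, mul_comm _ (L B)]
  rfl

end Value

section QuadraticPerturbation

variable {E : Type*} [NormedAddCommGroup E] [NormedSpace ℝ E] [FiniteDimensional ℝ E]
  {k₀ : C(X × Y, ℝ)} {L : E →ₗ[ℝ] C(X × Y, ℝ)} {T : E →ₗ[ℝ] E →ₗ[ℝ] ℝ} {V Φ : E → ℝ} {ε : ℝ}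

theorem hasFDerivAt_quadratic (hT : ∀ A B, T A B = T B A) (r : ℝ) (A : E) :
    HasFDerivAt (fun A => r * T A A) (((2 * r) • T.toContinuousBilinearMap) A) A := by
  have h := T.toContinuousBilinearMap.hasFDerivAt_of_bilinear (hasFDerivAt_id A) (hasFDerivAt_id A)
  refine (h.const_mul r).congr_fderiv ?_
  ext B
  change r * (T A B + T B A) = 2 * r * T A B
  rw [hT B A]
  ring

theorem contDiff_quadratic_add_value
    (hV : ∀ A w, IsSchrodinger ν₀ ν₁ (k₀ + L A) w → V A = integralL ν₀ w.1 + integralL ν₁ w.2)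
    (hΦ : ∀ A, Φ A = 32 * T A A + ε * V A) : ContDiff ℝ ∞ Φ := by
  rw [funext hΦ]
  exact (contDiff_const.mul (T.toContinuousBilinearMap.contDiff.clm_apply contDiff_id)).add
    (contDiff_const.mul (contDiff_value (L := LinearMap.toContinuousLinearMap L) hV))

theorem fderiv_quadratic_add_value (hT : ∀ A B, T A B = T B A)
    (hV : ∀ A w, IsSchrodinger ν₀ ν₁ (k₀ + L A) w → V A = integralL ν₀ w.1 + integralL ν₁ w.2)
    (hΦ : ∀ A, Φ A = 32 * T A A + ε * V A) :
    fderiv ℝ Φ = fun A => ((2 * 32 : ℝ) • T.toContinuousBilinearMap) A + ε • fderiv ℝ V A := by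
  ext1 A
  have hd : HasFDerivAt V _ A :=
    ((contDiff_value (L := LinearMap.toContinuousLinearMap L) hV).differentiable
      (by simp) A).hasFDerivAt
  rw [funext hΦ]
  exact ((hasFDerivAt_quadratic hT 32 A).add (hd.const_mul ε)).fderiv

theorem fderiv_quadratic_add_value_apply (hT : ∀ A B, T A B = T B A)
    (hV : ∀ A w, IsSchrodinger ν₀ ν₁ (k₀ + L A) w → V A = integralL ν₀ w.1 + integralL ν₁ w.2)
    (hΦ : ∀ A, Φ A = 32 * T A A + ε * V A) {A : E} {w : C(X, ℝ) × C(Y, ℝ)}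
    (hw : IsSchrodinger ν₀ ν₁ (k₀ + L A) w) (B : E) :
    fderiv ℝ Φ A B = 64 * T A B - ε * integralL (ν₀.prod ν₁) (gibbs (k₀ + L A) w * L B) := by
  have h := fderiv_value (L := LinearMap.toContinuousLinearMap L) hV hw B
  rw [fderiv_quadratic_add_value hT hV hΦ]
  change 2 * 32 * T A B + ε * fderiv ℝ V A B = _
  rw [h]
  norm_num [sub_eq_add_neg]

theorem fderiv_fderiv_quadratic_add_value_apply (hT : ∀ A B, T A B = T B A)
    (hV : ∀ A w, IsSchrodinger ν₀ ν₁ (k₀ + L A) w → V A = integralL ν₀ w.1 + integralL ν₁ w.2)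
    (hΦ : ∀ A, Φ A = 32 * T A A + ε * V A) {A : E} {w : C(X, ℝ) × C(Y, ℝ)}
    (hw : IsSchrodinger ν₀ ν₁ (k₀ + L A) w) (B C : E) {h : C(X, ℝ) × C(Y, ℝ)}
    (hh : IsLinSchrodinger ν₀ ν₁ (k₀ + L A) w (L C) h) :
    fderiv ℝ (fderiv ℝ Φ) A B C = 64 * T B C -
      ε * integralL (ν₀.prod ν₁) (gibbs (k₀ + L A) w * (sumL h + L C) * L B) := by
  have hs : ContDiff ℝ ∞ V := contDiff_value (L := LinearMap.toContinuousLinearMap L) hV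
  have hd : HasFDerivAt (fderiv ℝ V) _ A := ((hs.fderiv_right (m := 1)
    (WithTop.coe_le_coe.2 (le_top : (2 : ℕ∞) ≤ ⊤))).differentiable one_ne_zero A).hasFDerivAt
  have e := fderiv_fderiv_value (L := LinearMap.toContinuousLinearMap L) hV hw B C hh
  have hd' := ((((2 * 32 : ℝ) • T.toContinuousBilinearMap).hasFDerivAt (x := A)).add
    (hd.const_smul ε)).fderiv
  rw [fderiv_quadratic_add_value hT hV hΦ]
  refine (DFunLike.congr_fun (DFunLike.congr_fun hd' B) C).trans ?_
  change 2 * 32 * T B C + ε * fderiv ℝ (fderiv ℝ V) A B C = _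
  rw [e]
  norm_num [sub_eq_add_neg]

end QuadraticPerturbation

end

end EntropicTransport

/-! ### Passage between the whole spaces and the supports. -/

namespace EntropicTransport

noncomputable section

variable {X Y : Type*} [TopologicalSpace X] [T2Space X] [SecondCountableTopology X]
  [MeasurableSpace X] [BorelSpace X] [TopologicalSpace Y] [T2Space Y] [SecondCountableTopology Y]
  [MeasurableSpace Y] [BorelSpace Y]

/-- A measure, viewed on its support. -/
def supportMeasure (μ : Measure X) : Measure μ.support := μ.comap Subtype.val

theorem measurePreserving_supportMeasure (μ : Measure X) :
    MeasurePreserving (Subtype.val : μ.support → X) (supportMeasure μ) μ := by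
  refine ⟨measurable_subtype_coe, ?_⟩
  rw [supportMeasure, map_comap_subtype_coe μ.isClosed_support.measurableSet]
  exact Measure.restrict_eq_self_of_ae_mem (s := μ.support) Measure.support_mem_ae

instance (μ : Measure X) [IsProbabilityMeasure μ] : IsProbabilityMeasure (supportMeasure μ) := by
  have h := (measurePreserving_supportMeasure μ).map_eq
  have : IsProbabilityMeasure ((supportMeasure μ).map Subtype.val) := by rw [h]; infer_instance
  exact Measure.isProbabilityMeasure_of_map Subtype.val

theorem measurableEmbedding_support (μ : Measure X) :
    MeasurableEmbedding (Subtype.val : μ.support → X) :=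
  .subtype_coe μ.isClosed_support.measurableSet

theorem integral_supportMeasure (μ : Measure X) (f : X → ℝ) :
    ∫ x, f x.1 ∂supportMeasure μ = ∫ x, f x ∂μ :=
  (measurePreserving_supportMeasure μ).integral_comp (measurableEmbedding_support μ) f

theorem integral_prod_supportMeasure (μ₀ : Measure X) (μ₁ : Measure Y) [IsProbabilityMeasure μ₀]
    [IsProbabilityMeasure μ₁] (f : X × Y → ℝ) :
    ∫ z, f (z.1.1, z.2.1) ∂(supportMeasure μ₀).prod (supportMeasure μ₁) =
      ∫ z, f z ∂μ₀.prod μ₁ :=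
  ((measurePreserving_supportMeasure μ₀).prod (measurePreserving_supportMeasure μ₁)).integral_comp
    ((measurableEmbedding_support μ₀).prodMap (measurableEmbedding_support μ₁)) f

variable {μ₀ : Measure X} {μ₁ : Measure Y} [IsProbabilityMeasure μ₀] [IsProbabilityMeasure μ₁]
  [CompactSpace μ₀.support] [CompactSpace μ₁.support] {c : X → Y → ℝ} {ε : ℝ}
  {k : C(μ₀.support × μ₁.support, ℝ)}

/-- The restrictions of scaled potentials to the supports. -/
def restrictPotentials {φ₀ : X → ℝ} {φ₁ : Y → ℝ} (hφ : IsEOTPotentials μ₀ μ₁ c ε φ₀ φ₁) :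
    C(μ₀.support, ℝ) × C(μ₁.support, ℝ) :=
  (⟨fun x => φ₀ x / ε, (hφ.continuous_fst.comp continuous_subtype_val).div_const ε⟩,
    ⟨fun y => φ₁ y / ε, (hφ.continuous_snd.comp continuous_subtype_val).div_const ε⟩)

theorem gibbs_restrictPotentials (hk : ∀ z, k z = -(c z.1 z.2) / ε) {φ₀ : X → ℝ} {φ₁ : Y → ℝ}
    (hφ : IsEOTPotentials μ₀ μ₁ c ε φ₀ φ₁) (z : μ₀.support × μ₁.support) :
    gibbs k (restrictPotentials hφ) z = Real.exp ((φ₀ z.1 + φ₁ z.2 - c z.1 z.2) / ε) := by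
  rw [gibbs_apply, hk]
  change Real.exp (φ₀ z.1 / ε + φ₁ z.2 / ε + _) = _
  congr 1
  ring

theorem isSchrodinger_restrictPotentials (hk : ∀ z, k z = -(c z.1 z.2) / ε) {φ₀ : X → ℝ}
    {φ₁ : Y → ℝ} (hφ : IsEOTPotentials μ₀ μ₁ c ε φ₀ φ₁) :
    IsSchrodinger (supportMeasure μ₀) (supportMeasure μ₁) k (restrictPotentials hφ) := by
  constructor
  · ext x
    rw [partialIntegral_apply]
    simp only [gibbs_restrictPotentials hk]
    exact (integral_supportMeasure μ₁ _).trans (hφ.system_fst x)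
  · ext y
    rw [partialIntegralFst_apply]
    simp only [gibbs_restrictPotentials hk]
    exact (integral_supportMeasure μ₀
      (fun x => Real.exp ((φ₀ x + φ₁ y - c x y) / ε))).trans (hφ.system_snd y)

/-- The potential on the whole space that solves one of the Schrödinger equations, for a given
potential `ε v` on the support of the other marginal. -/
def softTransform (μ₁ : Measure Y) (c : X → Y → ℝ) (ε : ℝ) (v : C(μ₁.support, ℝ)) (x : X) : ℝ :=
  -ε * Real.log (∫ y : μ₁.support, Real.exp (v y - c x y / ε) ∂supportMeasure μ₁)

theorem softTransform_integral_pos (hc : Continuous (Function.uncurry c)) (v : C(μ₁.support, ℝ))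
    (x : X) : 0 < ∫ y : μ₁.support, Real.exp (v y - c x y / ε) ∂supportMeasure μ₁ :=
  integral_expMap_pos (supportMeasure μ₁) ⟨fun y => v y - c x y / ε, v.continuous.sub
    ((hc.comp (continuous_const.prodMk continuous_subtype_val)).div_const ε)⟩

theorem continuous_softTransform [LocallyCompactSpace X] (hc : Continuous (Function.uncurry c))
    (v : C(μ₁.support, ℝ)) : Continuous (softTransform μ₁ c ε v) := by
  have h := continuous_parametric_integral_of_continuous (μ := supportMeasure μ₁)
    (f := fun (x : X) (y : μ₁.support) => Real.exp (v y - c x y / ε)) (s := Set.univ)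
    (Real.continuous_exp.comp ((v.continuous.comp continuous_snd).sub
      ((hc.comp (continuous_fst.prodMk (continuous_subtype_val.comp continuous_snd))).div_const ε)))
    isCompact_univ
  simp only [Measure.restrict_univ] at h
  exact continuous_const.mul (h.log fun x => (softTransform_integral_pos hc v x).ne')

theorem integral_exp_softTransform (hc : Continuous (Function.uncurry c)) (hε : 0 < ε)
    (v : C(μ₁.support, ℝ)) (x : X) :
    ∫ y : μ₁.support, Real.exp (softTransform μ₁ c ε v x / ε + v y - c x y / ε)
      ∂supportMeasure μ₁ = 1 := by
  have hpos := softTransform_integral_pos (ε := ε) hc v x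
  simp only [add_sub_assoc, Real.exp_add (softTransform μ₁ c ε v x / ε), integral_const_mul]
  rw [softTransform, neg_mul, neg_div, mul_div_cancel_left₀ _ hε.ne', Real.exp_neg,
    Real.exp_log hpos, inv_mul_cancel₀ hpos.ne']

/-- A single normalization equation determines the potential at `x`. On the support the transform
therefore returns the given solution, so it extends that solution to the whole space. -/
theorem softTransform_eq (hε : 0 < ε) (v : C(μ₁.support, ℝ)) (x : X)
    {t : ℝ} (ht : ∫ y : μ₁.support, Real.exp (t + v y - c x y / ε) ∂supportMeasure μ₁ = 1) :
    softTransform μ₁ c ε v x / ε = t := by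
  simp only [add_sub_assoc, Real.exp_add t, integral_const_mul] at ht
  rw [softTransform, eq_inv_of_mul_eq_one_right ht, ← Real.exp_neg, Real.log_exp, neg_mul_neg,
    mul_div_cancel_left₀ _ hε.ne']

/-- Solutions on the supports extend to potentials on the whole spaces. -/
theorem IsSchrodinger.exists_isEOTPotentials [LocallyCompactSpace X] [LocallyCompactSpace Y]
    (hc : Continuous (Function.uncurry c)) (hε : 0 < ε) (hk : ∀ z, k z = -(c z.1 z.2) / ε)
    {w : C(μ₀.support, ℝ) × C(μ₁.support, ℝ)}
    (hw : IsSchrodinger (supportMeasure μ₀) (supportMeasure μ₁) k w) :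
    ∃ φ₀ φ₁, IsEOTPotentials μ₀ μ₁ c ε φ₀ φ₁ ∧ (∀ x : μ₀.support, φ₀ x = ε * w.1 x) ∧
      ∀ y : μ₁.support, φ₁ y = ε * w.2 y := by
  have hc' : Continuous (Function.uncurry fun y x => c x y) := hc.comp continuous_swap
  have e₀ : ∀ x : μ₀.support, softTransform μ₁ c ε w.2 x / ε = w.1 x := fun x =>
    softTransform_eq hε _ _ <| by
      have := hw.integral_fst x
      simpa only [hk, neg_div, ← sub_eq_add_neg] using this
  have e₁ : ∀ y : μ₁.support,
      softTransform μ₀ (fun y x => c x y) ε w.1 y / ε = w.2 y := fun y =>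
    softTransform_eq hε _ _ <| by
      have := hw.integral_snd y
      simpa only [hk, neg_div, ← sub_eq_add_neg, add_comm (w.2 y)] using this
  refine ⟨softTransform μ₁ c ε w.2, softTransform μ₀ (fun y x => c x y) ε w.1,
    ⟨continuous_softTransform hc _, continuous_softTransform hc' _, fun x => ?_, fun y => ?_⟩,
    fun x => ?_, fun y => ?_⟩
  · rw [← integral_supportMeasure, ← integral_exp_softTransform (ε := ε) hc hε w.2 x]
    simp only [add_div, sub_div, e₁]
  · rw [← integral_supportMeasure, ← integral_exp_softTransform (ε := ε) hc' hε w.1 y]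
    simp only [add_div, sub_div, e₀, add_comm (w.1 _)]
  · rw [← e₀, mul_div_cancel₀ _ hε.ne']
  · rw [← e₁, mul_div_cancel₀ _ hε.ne']

/-- The optimal value in terms of a solution of the Schrödinger system on the supports. -/
theorem IsSchrodinger.eotCost_eq [LocallyCompactSpace X] [LocallyCompactSpace Y]
    (hc : Continuous (Function.uncurry c)) (hε : 0 < ε) (hk : ∀ z, k z = -(c z.1 z.2) / ε)
    {w : C(μ₀.support, ℝ) × C(μ₁.support, ℝ)}
    (hw : IsSchrodinger (supportMeasure μ₀) (supportMeasure μ₁) k w) :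
    eotCost μ₀ μ₁ c ε = ((ε * (integralL (supportMeasure μ₀) w.1 +
      integralL (supportMeasure μ₁) w.2) : ℝ) : EReal) := by
  obtain ⟨φ₀, φ₁, hφ, h₀, h₁⟩ := hw.exists_isEOTPotentials hc hε hk
  rw [EntropicTransport.eotCost_eq (isCompact_iff_compactSpace.2 inferInstance)
    (isCompact_iff_compactSpace.2 inferInstance) hc hε hφ, ← integral_supportMeasure μ₀,
    ← integral_supportMeasure μ₁]
  simp only [h₀, h₁, integral_const_mul, integralL_apply, mul_add]

theorem integral_gibbsCoupling_eq (hc : Continuous (Function.uncurry c))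
    (hk : ∀ z, k z = -(c z.1 z.2) / ε) {φ₀ : X → ℝ} {φ₁ : Y → ℝ}
    (hφ : IsEOTPotentials μ₀ μ₁ c ε φ₀ φ₁) (f : X × Y → ℝ) :
    ∫ z, f z ∂gibbsCoupling μ₀ μ₁ c ε φ₀ φ₁ =
      ∫ z, gibbs k (restrictPotentials hφ) z * f (z.1.1, z.2.1)
        ∂(supportMeasure μ₀).prod (supportMeasure μ₁) := by
  rw [integral_gibbsCoupling (isCompact_iff_compactSpace.2 inferInstance)
    (isCompact_iff_compactSpace.2 inferInstance) hc hφ, ← integral_prod_supportMeasure]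
  simp only [gibbs_restrictPotentials hk, gibbsExponent]

end

end EntropicTransport

/-! ### The cost `c_A`: linearized solutions, derivatives and coercivity of `Phi`. -/

namespace EntropicTransport

noncomputable section

section Frobenius

variable {m n : ℕ}

/-- The Frobenius inner product, as a bilinear map. -/
def traceForm (m n : ℕ) : Matrix (Fin m) (Fin n) ℝ →ₗ[ℝ] Matrix (Fin m) (Fin n) ℝ →ₗ[ℝ] ℝ :=
  LinearMap.mk₂ ℝ (fun A B : Matrix (Fin m) (Fin n) ℝ => (Aᵀ * B).trace)
    (fun A A' B => by simp [Matrix.add_mul])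
    (fun c A B => by simp)
    (fun A B B' => by simp [Matrix.mul_add])
    (fun c A B => by simp)

theorem trace_transpose_mul_comm (A B : Matrix (Fin m) (Fin n) ℝ) :
    (Aᵀ * B).trace = (Bᵀ * A).trace := by
  rw [← Matrix.trace_transpose, Matrix.transpose_mul, Matrix.transpose_transpose]

theorem frobenius_norm_sq (A : Matrix (Fin m) (Fin n) ℝ) : ‖A‖ ^ 2 = (Aᵀ * A).trace := by
  rw [Matrix.frobenius_norm_def, ← Real.sqrt_eq_rpow, Real.sq_sqrt (by positivity),
    Matrix.trace, Finset.sum_comm]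
  simp [Matrix.mul_apply, sq]

end Frobenius

variable {d₀ d₁ : ℕ} {μ₀ : Measure (EuclideanSpace ℝ (Fin d₀))}
  {μ₁ : Measure (EuclideanSpace ℝ (Fin d₁))}

theorem continuous_bilin (A : Matrix (Fin d₀) (Fin d₁) ℝ) :
    Continuous fun z : EuclideanSpace ℝ (Fin d₀) × EuclideanSpace ℝ (Fin d₁) =>
      bilin A z.1 z.2 := by
  unfold bilin
  fun_prop

theorem continuous_costA (A : Matrix (Fin d₀) (Fin d₁) ℝ) :
    Continuous (Function.uncurry (costA A)) := by
  have := continuous_bilin A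
  unfold Function.uncurry costA
  fun_prop

variable (μ₀ μ₁) in
/-- The part of `-c_A / ε` that does not depend on `A`, on the supports. -/
def exponentConst (ε : ℝ) : C(μ₀.support × μ₁.support, ℝ) :=
  ⟨fun z => 4 * ‖z.1.1‖ ^ 2 * ‖z.2.1‖ ^ 2 / ε, by fun_prop⟩

variable [CompactSpace μ₀.support] [CompactSpace μ₁.support]

variable (μ₀ μ₁) in
/-- The part of `-c_A / ε` that is linear in `A`, on the supports. -/
def exponentLinear (ε : ℝ) : Matrix (Fin d₀) (Fin d₁) ℝ →ₗ[ℝ] C(μ₀.support × μ₁.support, ℝ) where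
  toFun A := ⟨fun z => 32 / ε * bilin A z.1 z.2, continuous_const.mul
    ((continuous_bilin A).comp (continuous_subtype_val.prodMap continuous_subtype_val))⟩
  map_add' A B := by
    ext z
    simp [bilin, Matrix.add_mulVec, mul_add]
  map_smul' c A := by
    ext z
    simp [bilin, Matrix.smul_mulVec]
    ring

variable (μ₀ μ₁) in
theorem exists_norm_exponentLinear_le (ε : ℝ) : ∃ K, ∀ A : Matrix (Fin d₀) (Fin d₁) ℝ,
    ‖exponentLinear μ₀ μ₁ ε A‖ ≤ K * ‖A‖ :=
  ⟨_, (LinearMap.toContinuousLinearMap (𝕜 := ℝ) (E := Matrix (Fin d₀) (Fin d₁) ℝ)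
    (exponentLinear μ₀ μ₁ ε)).le_opNorm⟩

theorem exponentLinear_apply (ε : ℝ) (A : Matrix (Fin d₀) (Fin d₁) ℝ)
    (z : μ₀.support × μ₁.support) :
    exponentLinear μ₀ μ₁ ε A z = 32 / ε * bilin A z.1 z.2 := rfl

theorem exponent_apply (ε : ℝ) (A : Matrix (Fin d₀) (Fin d₁) ℝ)
    (z : μ₀.support × μ₁.support) :
    (exponentConst μ₀ μ₁ ε + exponentLinear μ₀ μ₁ ε A) z = -(costA A z.1 z.2) / ε := by
  change 4 * ‖z.1.1‖ ^ 2 * ‖z.2.1‖ ^ 2 / ε + 32 / ε * bilin A z.1 z.2 = _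
  unfold costA
  ring

variable [IsProbabilityMeasure μ₀] [IsProbabilityMeasure μ₁] {ε : ℝ}
  {A C : Matrix (Fin d₀) (Fin d₁) ℝ} {φ₀ : EuclideanSpace ℝ (Fin d₀) → ℝ}
  {φ₁ : EuclideanSpace ℝ (Fin d₁) → ℝ}

/-- Moving `A` in the direction `C` changes the exponent by `(32 / ε) xᵀ C y`, while the system for
`h₀, h₁` contains `-32 xᵀ C y`: hence the factor `-ε`. -/
theorem isLinearizedSolution_iff (hε : 0 < ε) (hφ : IsEOTPotentials μ₀ μ₁ (costA A) ε φ₀ φ₁)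
    {h₀ : EuclideanSpace ℝ (Fin d₀) → ℝ} {h₁ : EuclideanSpace ℝ (Fin d₁) → ℝ}
    {h : C(μ₀.support, ℝ) × C(μ₁.support, ℝ)} (e₀ : ∀ x : μ₀.support, h₀ x = -ε * h.1 x)
    (e₁ : ∀ y : μ₁.support, h₁ y = -ε * h.2 y) :
    IsLinearizedSolution μ₀ μ₁ ε A C φ₀ φ₁ h₀ h₁ ↔
      IsLinSchrodinger (supportMeasure μ₀) (supportMeasure μ₁)
        (exponentConst μ₀ μ₁ ε + exponentLinear μ₀ μ₁ ε A) (restrictPotentials hφ)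
        (exponentLinear μ₀ μ₁ ε C) h := by
  have key : ∀ z : μ₀.support × μ₁.support, (h₀ z.1 + h₁ z.2 - 32 * bilin C z.1 z.2) *
      Real.exp ((φ₀ z.1 + φ₁ z.2 - costA A z.1 z.2) / ε) =
      -ε * (gibbs (exponentConst μ₀ μ₁ ε + exponentLinear μ₀ μ₁ ε A) (restrictPotentials hφ) *
        (sumL h + exponentLinear μ₀ μ₁ ε C)) z := fun z => by
    rw [ContinuousMap.mul_apply, gibbs_restrictPotentials (exponent_apply ε A) hφ,
      ContinuousMap.add_apply, sumL_apply, exponentLinear_apply, e₀, e₁]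
    field_simp
    ring
  have k₀ : ∀ x : μ₀.support, ∫ y, (h₀ x + h₁ y - 32 * bilin C x y) *
      Real.exp ((φ₀ x + φ₁ y - costA A x y) / ε) ∂μ₁ =
      -ε * partialIntegral μ₀.support (supportMeasure μ₁)
        (gibbs (exponentConst μ₀ μ₁ ε + exponentLinear μ₀ μ₁ ε A) (restrictPotentials hφ) *
        (sumL h + exponentLinear μ₀ μ₁ ε C)) x := fun x => by
    rw [← integral_supportMeasure, partialIntegral_apply, ← integral_const_mul]
    exact integral_congr_ae (ae_of_all _ fun y => key (x, y))
  have k₁ : ∀ y : μ₁.support, ∫ x, (h₀ x + h₁ y - 32 * bilin C x y) *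
      Real.exp ((φ₀ x + φ₁ y - costA A x y) / ε) ∂μ₀ =
      -ε * partialIntegralFst (supportMeasure μ₀) μ₁.support
        (gibbs (exponentConst μ₀ μ₁ ε + exponentLinear μ₀ μ₁ ε A) (restrictPotentials hφ) *
        (sumL h + exponentLinear μ₀ μ₁ ε C)) y := fun y => by
    rw [← integral_supportMeasure, partialIntegralFst_apply, ← integral_const_mul]
    exact integral_congr_ae (ae_of_all _ fun x => key (x, y))
  have hne : -ε ≠ 0 := neg_ne_zero.2 hε.ne'
  constructor
  · intro hs
    refine ⟨ContinuousMap.ext fun x => ?_, ContinuousMap.ext fun y => ?_⟩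
    · exact (mul_eq_zero_iff_left hne).1 ((k₀ x).symm.trans (hs.system_fst x x.2))
    · exact (mul_eq_zero_iff_left hne).1 ((k₁ y).symm.trans (hs.system_snd y y.2))
  · intro hs
    refine ⟨?_, ?_, fun x hx => ?_, fun y hy => ?_⟩
    · rw [continuousOn_iff_continuous_domRestrict]
      exact (continuous_const.mul h.1.continuous).congr fun x => (e₀ x).symm
    · rw [continuousOn_iff_continuous_domRestrict]
      exact (continuous_const.mul h.2.continuous).congr fun y => (e₁ y).symm
    · refine (k₀ ⟨x, hx⟩).trans ?_
      rw [hs.1]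
      simp
    · refine (k₁ ⟨y, hy⟩).trans ?_
      rw [hs.2]
      simp

/-- The restriction of a linearized solution to the supports. -/
theorem _root_.IsLinearizedSolution.exists_restrict (hε : 0 < ε)
    (hφ : IsEOTPotentials μ₀ μ₁ (costA A) ε φ₀ φ₁)
    {h₀ : EuclideanSpace ℝ (Fin d₀) → ℝ} {h₁ : EuclideanSpace ℝ (Fin d₁) → ℝ}
    (hs : IsLinearizedSolution μ₀ μ₁ ε A C φ₀ φ₁ h₀ h₁) :
    ∃ h : C(μ₀.support, ℝ) × C(μ₁.support, ℝ),
      IsLinSchrodinger (supportMeasure μ₀) (supportMeasure μ₁)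
        (exponentConst μ₀ μ₁ ε + exponentLinear μ₀ μ₁ ε A) (restrictPotentials hφ)
        (exponentLinear μ₀ μ₁ ε C) h ∧
      (∀ x : μ₀.support, h₀ x = -ε * h.1 x) ∧ ∀ y : μ₁.support, h₁ y = -ε * h.2 y := by
  have c₀ := continuousOn_iff_continuous_domRestrict.1 hs.continuousOn_fst
  have c₁ := continuousOn_iff_continuous_domRestrict.1 hs.continuousOn_snd
  set h : C(μ₀.support, ℝ) × C(μ₁.support, ℝ) :=
    (⟨fun x => -ε⁻¹ * h₀ x, continuous_const.mul c₀⟩,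
      ⟨fun y => -ε⁻¹ * h₁ y, continuous_const.mul c₁⟩) with hh
  have e₀ : ∀ x : μ₀.support, h₀ x = -ε * h.1 x := fun x => by
    change _ = -ε * (-ε⁻¹ * h₀ x)
    field_simp
  have e₁ : ∀ y : μ₁.support, h₁ y = -ε * h.2 y := fun y => by
    change _ = -ε * (-ε⁻¹ * h₁ y)
    field_simp
  exact ⟨h, (isLinearizedSolution_iff hε hφ e₀ e₁).1 hs, e₀, e₁⟩

theorem exists_isLinearizedSolution (hε : 0 < ε)
    (hφ : IsEOTPotentials μ₀ μ₁ (costA A) ε φ₀ φ₁) :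
    ∃ h₀ h₁, IsLinearizedSolution μ₀ μ₁ ε A C φ₀ φ₁ h₀ h₁ := by
  obtain ⟨h, hh⟩ := (isSchrodinger_restrictPotentials (exponent_apply ε A)
    hφ).exists_isLinSchrodinger (exponentLinear μ₀ μ₁ ε C)
  -- The extension by zero is harmless, since only values on the supports enter.
  refine ⟨Function.extend Subtype.val (fun x => -ε * h.1 x) 0,
    Function.extend Subtype.val (fun y => -ε * h.2 y) 0,
    (isLinearizedSolution_iff hε hφ (fun x => ?_) (fun y => ?_)).2 hh⟩
  · exact Subtype.val_injective.extend_apply _ _ x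
  · exact Subtype.val_injective.extend_apply _ _ y

/-- Solutions of the linearized system are unique up to additive constants. -/
theorem _root_.IsLinearizedSolution.unique (hε : 0 < ε)
    (hφ : IsEOTPotentials μ₀ μ₁ (costA A) ε φ₀ φ₁)
    {h₀ k₀ : EuclideanSpace ℝ (Fin d₀) → ℝ} {h₁ k₁ : EuclideanSpace ℝ (Fin d₁) → ℝ}
    (hs : IsLinearizedSolution μ₀ μ₁ ε A C φ₀ φ₁ h₀ h₁)
    (ks : IsLinearizedSolution μ₀ μ₁ ε A C φ₀ φ₁ k₀ k₁) :
    ∃ a : ℝ, (∀ x ∈ μ₀.support, k₀ x = h₀ x + a) ∧ ∀ y ∈ μ₁.support, k₁ y = h₁ y - a := by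
  obtain ⟨h, hh, e₀, e₁⟩ := hs.exists_restrict hε hφ
  obtain ⟨k, hk, f₀, f₁⟩ := ks.exists_restrict hε hφ
  obtain ⟨a, ha₀, ha₁⟩ := IsLinSchrodinger.unique
    (isSchrodinger_restrictPotentials (exponent_apply ε A) hφ) hh hk
  refine ⟨-ε * a, fun x hx => ?_, fun y hy => ?_⟩
  · rw [f₀ ⟨x, hx⟩, e₀ ⟨x, hx⟩, ha₀, mul_add]
  · rw [f₁ ⟨y, hy⟩, e₁ ⟨y, hy⟩, ha₁, mul_sub]

theorem exists_isEOTPotentials (hε : 0 < ε) (A : Matrix (Fin d₀) (Fin d₁) ℝ) :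
    ∃ φ₀ φ₁, IsEOTPotentials μ₀ μ₁ (costA A) ε φ₀ φ₁ := by
  obtain ⟨w, hw, -⟩ := exists_isSchrodinger (ν₀ := supportMeasure μ₀) (ν₁ := supportMeasure μ₁)
    (exponentConst μ₀ μ₁ ε + exponentLinear μ₀ μ₁ ε A)
  obtain ⟨φ₀, φ₁, hφ, -⟩ :=
    hw.exists_isEOTPotentials (continuous_costA A) hε (exponent_apply ε A)
  exact ⟨φ₀, φ₁, hφ⟩

variable (μ₀ μ₁ ε) in
/-- The optimal value, divided by `ε`. -/
def scaledValue (A : Matrix (Fin d₀) (Fin d₁) ℝ) : ℝ :=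
  ε⁻¹ * (eotCost μ₀ μ₁ (costA A) ε).toReal

theorem scaledValue_eq (hε : 0 < ε) (A : Matrix (Fin d₀) (Fin d₁) ℝ)
    (w : C(μ₀.support, ℝ) × C(μ₁.support, ℝ))
    (hw : IsSchrodinger (supportMeasure μ₀) (supportMeasure μ₁)
      (exponentConst μ₀ μ₁ ε + exponentLinear μ₀ μ₁ ε A) w) :
    scaledValue μ₀ μ₁ ε A =
      integralL (supportMeasure μ₀) w.1 + integralL (supportMeasure μ₁) w.2 := by
  rw [scaledValue, hw.eotCost_eq (continuous_costA A) hε (exponent_apply ε A), EReal.toReal_coe,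
    inv_mul_cancel_left₀ hε.ne']

omit [CompactSpace μ₀.support] [CompactSpace μ₁.support]
  [IsProbabilityMeasure μ₀] [IsProbabilityMeasure μ₁] in
theorem Phi_eq (hε : 0 < ε) (A : Matrix (Fin d₀) (Fin d₁) ℝ) :
    Phi μ₀ μ₁ ε A = 32 * traceForm d₀ d₁ A A + ε * scaledValue μ₀ μ₁ ε A := by
  rw [Phi, scaledValue, mul_inv_cancel_left₀ hε.ne', frobenius_norm_sq]
  rfl

theorem contDiff_Phi (hε : 0 < ε) : ContDiff ℝ ∞ (Phi μ₀ μ₁ ε) :=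
  contDiff_quadratic_add_value (scaledValue_eq hε) (Phi_eq hε)

theorem fderiv_Phi_apply (hε : 0 < ε) {A : Matrix (Fin d₀) (Fin d₁) ℝ}
    {w : C(μ₀.support, ℝ) × C(μ₁.support, ℝ)}
    (hw : IsSchrodinger (supportMeasure μ₀) (supportMeasure μ₁)
      (exponentConst μ₀ μ₁ ε + exponentLinear μ₀ μ₁ ε A) w) (B : Matrix (Fin d₀) (Fin d₁) ℝ) :
    fderiv ℝ (Phi μ₀ μ₁ ε) A B = 64 * (Aᵀ * B).trace -
      ε * integralL ((supportMeasure μ₀).prod (supportMeasure μ₁))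
        (gibbs (exponentConst μ₀ μ₁ ε + exponentLinear μ₀ μ₁ ε A) w *
          exponentLinear μ₀ μ₁ ε B) :=
  fderiv_quadratic_add_value_apply (T := traceForm d₀ d₁) trace_transpose_mul_comm
    (scaledValue_eq hε) (Phi_eq hε) hw B

theorem fderiv_fderiv_Phi_apply (hε : 0 < ε) {A : Matrix (Fin d₀) (Fin d₁) ℝ}
    {w : C(μ₀.support, ℝ) × C(μ₁.support, ℝ)}
    (hw : IsSchrodinger (supportMeasure μ₀) (supportMeasure μ₁)
      (exponentConst μ₀ μ₁ ε + exponentLinear μ₀ μ₁ ε A) w) (B C : Matrix (Fin d₀) (Fin d₁) ℝ)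
    {h : C(μ₀.support, ℝ) × C(μ₁.support, ℝ)}
    (hh : IsLinSchrodinger (supportMeasure μ₀) (supportMeasure μ₁)
      (exponentConst μ₀ μ₁ ε + exponentLinear μ₀ μ₁ ε A) w (exponentLinear μ₀ μ₁ ε C) h) :
    fderiv ℝ (fderiv ℝ (Phi μ₀ μ₁ ε)) A B C = 64 * (Bᵀ * C).trace -
      ε * integralL ((supportMeasure μ₀).prod (supportMeasure μ₁))
        (gibbs (exponentConst μ₀ μ₁ ε + exponentLinear μ₀ μ₁ ε A) w *
          (sumL h + exponentLinear μ₀ μ₁ ε C) * exponentLinear μ₀ μ₁ ε B) :=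
  fderiv_fderiv_quadratic_add_value_apply (T := traceForm d₀ d₁) trace_transpose_mul_comm
    (scaledValue_eq hε) (Phi_eq hε) hw B C hh

/-- The divergence is nonnegative, and on the supports `|c_A|` is at most `ε` times the norm of an
exponent affine in `A`. -/
theorem neg_le_toReal_eotCost (hε : 0 < ε) {K : ℝ}
    (hK : ∀ A : Matrix (Fin d₀) (Fin d₁) ℝ, ‖exponentLinear μ₀ μ₁ ε A‖ ≤ K * ‖A‖)
    (A : Matrix (Fin d₀) (Fin d₁) ℝ) :
    -(ε * (‖exponentConst μ₀ μ₁ ε‖ + K * ‖A‖)) ≤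
      (eotCost μ₀ μ₁ (costA A) ε).toReal := by
  obtain ⟨φ₀, φ₁, hφ⟩ := exists_isEOTPotentials (μ₀ := μ₀) (μ₁ := μ₁) hε A
  have hcost := eotCost_eq (isCompact_iff_compactSpace.2 inferInstance)
    (isCompact_iff_compactSpace.2 inferInstance) (continuous_costA A) hε hφ
  have hle : ((-(ε * (‖exponentConst μ₀ μ₁ ε‖ + K * ‖A‖)) : ℝ) : EReal) ≤
      eotCost μ₀ μ₁ (costA A) ε := by
    refine le_iInf₂ fun π hπ => ?_
    have := isProbabilityMeasure_of_mem_couplings hπ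
    have hb : ‖∫ z, costA A z.1 z.2 ∂π‖ ≤
        ε * (‖exponentConst μ₀ μ₁ ε‖ + K * ‖A‖) := by
      refine (norm_integral_le_of_norm_le_const
        (C := ε * (‖exponentConst μ₀ μ₁ ε‖ + K * ‖A‖)) ?_).trans_eq
          (by simp)
      filter_upwards [ae_mem_support_of_mem_couplings hπ] with z hz
      have e : costA A z.1 z.2 =
          -ε * (exponentConst μ₀ μ₁ ε + exponentLinear μ₀ μ₁ ε A) (⟨z.1, hz.1⟩, ⟨z.2, hz.2⟩) := by
        rw [exponent_apply]
        field_simp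
      rw [e, norm_mul, norm_neg, Real.norm_of_nonneg hε.le]
      gcongr
      exact (ContinuousMap.norm_coe_le_norm _ _).trans ((norm_add_le _ _).trans
        (add_le_add_right (hK A) _))
    refine le_trans (EReal.coe_le_coe_iff.2 (neg_le_of_abs_le hb)) (le_add_of_nonneg_right ?_)
    exact mul_nonneg (EReal.coe_nonneg.2 hε.le) (EReal.coe_ennreal_nonneg _)
  -- Finiteness, from duality, is needed to pass to real numbers: `toReal` sends `⊤` to `0`.
  rw [hcost] at hle ⊢
  exact EReal.coe_le_coe_iff.1 hle

theorem tendsto_Phi (hε : 0 < ε) :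
    Tendsto (Phi μ₀ μ₁ ε) (comap (fun A : Matrix (Fin d₀) (Fin d₁) ℝ => ‖A‖) atTop) atTop := by
  obtain ⟨K, hK⟩ := exists_norm_exponentLinear_le μ₀ μ₁ ε
  set a := ε * ‖exponentConst μ₀ μ₁ ε‖
  set b := ε * K
  -- With `t = ‖A‖` this is the lower bound `32 t² - b t - a` for `Phi`, factored so that divergence
  -- of both factors suffices whatever the sign of `b`.
  have hq : Tendsto (fun t : ℝ => t * (32 * t - b) - a) atTop atTop :=
    tendsto_atTop_add_const_right _ _ (tendsto_id.atTop_mul_atTop₀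
      (tendsto_atTop_add_const_right _ _ (tendsto_id.const_mul_atTop (by norm_num))))
  refine tendsto_atTop_mono (fun A => ?_) (hq.comp tendsto_comap)
  have := neg_le_toReal_eotCost (μ₀ := μ₀) (μ₁ := μ₁) hε hK A
  simp only [Function.comp, Phi]
  linarith

end

end EntropicTransport

/-! ### Assembly of the theorem. -/

open EntropicTransport in
theorem proposition2 {d₀ d₁ : ℕ}
    (μ₀ : Measure (EuclideanSpace ℝ (Fin d₀))) (μ₁ : Measure (EuclideanSpace ℝ (Fin d₁)))
    [IsProbabilityMeasure μ₀] [IsProbabilityMeasure μ₁]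
    (hμ₀ : IsCompact μ₀.support) (hμ₁ : IsCompact μ₁.support)
    (ε : ℝ) (hε : 0 < ε) :
    -- the EOT cost is finite, so that `Phi` is the objective of the variational problem
    (∀ A : Matrix (Fin d₀) (Fin d₁) ℝ,
      ((eotCost μ₀ μ₁ (costA A) ε).toReal : EReal) = eotCost μ₀ μ₁ (costA A) ε) ∧
    -- smoothness and coercivity
    ContDiff ℝ ∞ (Phi μ₀ μ₁ ε : Matrix (Fin d₀) (Fin d₁) ℝ → ℝ) ∧
    Tendsto (Phi μ₀ μ₁ ε)
      (comap (fun A : Matrix (Fin d₀) (Fin d₁) ℝ => ‖A‖) atTop) atTop ∧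
    ∀ A : Matrix (Fin d₀) (Fin d₁) ℝ,
      -- existence and uniqueness of the EOT coupling, existence of EOT potentials
      (∃! π, IsEOTCoupling μ₀ μ₁ (costA A) ε π) ∧
      (∃ φ₀ φ₁, IsEOTPotentials μ₀ μ₁ (costA A) ε φ₀ φ₁) ∧
      ∀ π, IsEOTCoupling μ₀ μ₁ (costA A) ε π →
        -- the first derivative
        (∀ B : Matrix (Fin d₀) (Fin d₁) ℝ,
          fderiv ℝ (Phi μ₀ μ₁ ε) A B =
            64 * (Aᵀ * B).trace - 32 * ∫ z, bilin B z.1 z.2 ∂π) ∧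
        ∀ φ₀ φ₁, IsEOTPotentials μ₀ μ₁ (costA A) ε φ₀ φ₁ →
          ∀ C : Matrix (Fin d₀) (Fin d₁) ℝ,
            -- the linearized system has a solution, unique up to additive constants
            (∃ h₀ h₁, IsLinearizedSolution μ₀ μ₁ ε A C φ₀ φ₁ h₀ h₁) ∧
            (∀ h₀ h₁ k₀ k₁, IsLinearizedSolution μ₀ μ₁ ε A C φ₀ φ₁ h₀ h₁ →
              IsLinearizedSolution μ₀ μ₁ ε A C φ₀ φ₁ k₀ k₁ →
              ∃ a : ℝ, (∀ x ∈ μ₀.support, k₀ x = h₀ x + a) ∧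
                ∀ y ∈ μ₁.support, k₁ y = h₁ y - a) ∧
            -- the second derivative
            ∀ h₀ h₁, IsLinearizedSolution μ₀ μ₁ ε A C φ₀ φ₁ h₀ h₁ →
              ∀ B : Matrix (Fin d₀) (Fin d₁) ℝ,
                fderiv ℝ (fderiv ℝ (Phi μ₀ μ₁ ε)) A B C =
                  64 * (Bᵀ * C).trace +
                    32 * ε⁻¹ * ∫ z, bilin B z.1 z.2 *
                      (h₀ z.1 + h₁ z.2 - 32 * bilin C z.1 z.2) ∂π := by

  have : CompactSpace μ₀.support := isCompact_iff_compactSpace.1 hμ₀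
  have : CompactSpace μ₁.support := isCompact_iff_compactSpace.1 hμ₁
  refine ⟨fun A => ?_, contDiff_Phi hε, tendsto_Phi hε, fun A => ?_⟩
  · obtain ⟨φ₀, φ₁, hφ⟩ := exists_isEOTPotentials (μ₀ := μ₀) (μ₁ := μ₁) hε A
    rw [eotCost_eq hμ₀ hμ₁ (continuous_costA A) hε hφ, EReal.toReal_coe]
  have hEx := exists_isEOTPotentials (μ₀ := μ₀) (μ₁ := μ₁) hε A
  refine ⟨?_, hEx, fun π hπ => ⟨fun B => ?_, fun φ₀ φ₁ hφ C => ⟨exists_isLinearizedSolution hε hφ,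
    fun h₀ h₁ k₀ k₁ hs ks => hs.unique hε hφ ks, fun h₀ h₁ hs B => ?_⟩⟩⟩
  · obtain ⟨φ₀, φ₁, hφ⟩ := hEx
    simp only [isEOTCoupling_iff hμ₀ hμ₁ (continuous_costA A) hε hφ]
    exact existsUnique_eq
  · obtain ⟨φ₀, φ₁, hφ⟩ := hEx
    have hw := isSchrodinger_restrictPotentials (exponent_apply ε A) hφ
    rw [(isEOTCoupling_iff hμ₀ hμ₁ (continuous_costA A) hε hφ).1 hπ,
      integral_gibbsCoupling_eq (continuous_costA A) (exponent_apply ε A) hφ,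
      fderiv_Phi_apply hε hw, integralL_apply, ← integral_const_mul, ← integral_const_mul]
    congr 2
    ext z
    rw [ContinuousMap.mul_apply, exponentLinear_apply]
    field_simp
  · have hw := isSchrodinger_restrictPotentials (exponent_apply ε A) hφ
    obtain ⟨h, hh, e₀, e₁⟩ := hs.exists_restrict hε hφ
    rw [(isEOTCoupling_iff hμ₀ hμ₁ (continuous_costA A) hε hφ).1 hπ,
      integral_gibbsCoupling_eq (continuous_costA A) (exponent_apply ε A) hφ,
      fderiv_fderiv_Phi_apply hε hw B C hh, integralL_apply, sub_eq_add_neg,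
      ← integral_const_mul, ← integral_const_mul, ← integral_neg]
    congr 2
    ext z
    simp only [ContinuousMap.mul_apply, ContinuousMap.add_apply, sumL_apply, exponentLinear_apply,
      e₀, e₁]
    field_simp
    ring
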